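/- **Setting.** Energy-momenta $q=(\omega,\mathbf p)$ range over $P=\Omega\times K$, where $\Omega$ and $K$ are measurable abelian groups with $\sigma$-finite measures invariant under $x\mapsto -x$ (e.g. $\Omega=\mathbb R$, $K=\mathbb R^d$ with Lebesgue measure, or lattices with counting measure), negation is measurable, and the diagonal of $\Omega\times\Omega$ is measurable. There is one kind of particle, with measurable dispersion law $\omega(\mathbf p)$; the *mass shell* consists of the momenta $(\omega(\mathbf p),\mathbf p)$ and their negatives. A perturbative theory is given by the following data. - Propagators $G_{\epsilon\epsilon'}$, $\epsilon,\epsilon'\in\{+1,-1\}$, with $G_{\epsilon\epsilon'}(q)=G_{\epsilon'\epsilon}(-q)$: $G_{++},G_{--}$ are functions (singularities are regularized), while $G_{+-},G_{-+}$ are on shell, i.e. $G_{\pm\mp}(q)\,dq=M_{\pm\mp}(q)\,d\sigma(q)$ with $d\sigma=\delta(\omega-\omega(\mathbf p))\,d\omega\,d\mathbf p+\delta(\omega+\omega(-\mathbf p))\,d\omega\,d\mathbf p$. - Vertices of two types $\epsilon=\pm1$ and of orders $j\ge1$ in the coupling constant. Such a vertex with incoming momenta $r_1,\dots,r_m$ contributes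 $\Delta(r_1+\dots+r_m)\,V_{\epsilon,j}(r_1,\dots,r_m)$, where $V_{\epsilon,j}$ is symmetric and $\Delta$ is the momentum-conservation factor (a Kronecker or nascent delta function; any function is allowed). The degree $m$ of vertices of order $j$ is bounded by a number depending on $j$. A *diagram* for $\hat G_n(p_1,\epsilon_1,\dots,p_n,\epsilon_n)$ is a non-empty connected graph (multiple edges and loops allowed) whose vertices carry a type and an order, with $n$ labelled amputated external legs, the $i$-th attached to a vertex of type $\epsilon_i$ and bringing in the momentum $p_i$; its order $N$ is the sum of the orders of its vertices. An edge with momentum $q$ and ends $u,v$ brings $q$ into $u$ and $-q$ into $v$ and carries the propagator $G_{\epsilon_u\epsilon_v}(q)$. The contribution of the diagram is the integral over all edge momenta of the product of propagators and vertex factors, divided by the order of its automorphism group. The order-$N$ term $\hat G_n^{(N)}$ of the connected amputated GGreen function is the (finite) sum of the contributions of all diagrams of order $N$. Assume that at on-shell external momenta all these integrals converge absolutely. **Statement.** Let $1\le k\le n-1$, let $p_1,\dots,p_n$ be on shell, $\epsilon_i=\pm1$, $N\ge0$. A $+-$ edge *separates $p_1,\dots,p_k$ from $p_{k+1},\dots,p_n$*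 if removing it disconnects the diagram so that the legs $1,\dots,k$ are in the component of its $+$ end and the legs $k+1,\dots,n$ are in the component of its $-$ end. Then the integral $$I_N=\int dq\,G_{+-}(q)\sum_{a+b=N}\hat G^{(a)}_{k+1}(p_1,\epsilon_1,\dots,p_k,\epsilon_k,q,+1)\,\hat G^{(b)}_{n-k+1}(p_{k+1},\epsilon_{k+1},\dots,p_n,\epsilon_n,-q,-1)$$ converges absolutely, and: 1. the sum of all diagrams of order $N$ for $\hat G_n(p_1,\epsilon_1,\dots,p_n,\epsilon_n)$, each counted once for every $+-$ edge in it that separates $p_1,\dots,p_k$ from $p_{k+1},\dots,p_n$, equals $I_N$; 2. if the theory is renormalized, in the sense that the on-shell amputated two-point function $\hat G^{(N')}_2(q,+1,q',-1)$ vanishes for all on-shell $q,q'$ and all $N'$, then the sum of all diagrams of order $N$ for $\hat G_n(p_1,\epsilon_1,\dots,p_n,\epsilon_n)$ that contain a $+-$ edge separating $p_1,\dots,p_k$ from $p_{k+1},\dots,p_n$ (each counted once) equals $I_N$. -/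

import Mathlib

open MeasureTheory

noncomputable section

namespace GGreen

/-- A (labelled) Feynman diagram with `n` external legs and vertices of two types.
The vertices are `0, …, V - 1` and the internal edges are `0, …, E - 1`; multiple edges and
self-loops are allowed. The edge `e` joins `src e` and `tgt e`, the `i`-th external leg is attached
to `leg i`, `sgn v = ±1` is the type of the vertex `v`, and `ord v` is the order in the
coupling constant of the interaction term sitting at `v`. -/
structure Diagram (n : ℕ) where
  V : ℕ
  E : ℕ
  src : Fin E → Fin V
  tgt : Fin E → Fin V
  leg : Fin n → Fin V
  sgn : Fin V → ℤˣ
  ord : Fin V → ℕ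

namespace Diagram

variable {n : ℕ} (D : Diagram n)

/-- `u` and `v` can be joined by a path all of whose edges lie in `S`. -/
def Linked (S : Set (Fin D.E)) (u v : Fin D.V) : Prop :=
  Relation.EqvGen (fun a b => ∃ f ∈ S, D.src f = a ∧ D.tgt f = b) u v

/-- The diagram is non-empty and connected. -/
def IsConnected : Prop :=
  0 < D.V ∧ ∀ u v, D.Linked Set.univ u v

/-- The number of lines (external legs and ends of internal edges) that meet at `v`. -/
def degree (v : Fin D.V) : ℕ :=
  (Finset.univ.filter fun i => D.leg i = v).card
    + (Finset.univ.filter fun e => D.src e = v).card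
    + (Finset.univ.filter fun e => D.tgt e = v).card

/-- The momenta flowing into the vertex `v` when the `i`-th external leg brings in `p i` and the
edge `e` brings `q e` into `src e` and `-q e` into `tgt e`. -/
def incoming {P : Type*} [AddCommGroup P] (p : Fin n → P) (q : Fin D.E → P) (v : Fin D.V) :
    Multiset P :=
  (Finset.univ.filter fun i => D.leg i = v).val.map p
    + (Finset.univ.filter fun e => D.src e = v).val.map q
    + (Finset.univ.filter fun e => D.tgt e = v).val.map (fun e => -q e)

/-- The weight of a labelled diagram. A diagram without labels arises from
`V! 2 ^ E E! / |Aut|` labelled ones (by permuting the vertices, permuting the edges and exchanging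
`src` and `tgt`), so that summing labelled diagrams with this weight amounts to summing
isomorphism classes of diagrams with the usual symmetry factors `1 / |Aut|`. -/
def weight : ℂ :=
  ((D.V.factorial * (2 ^ D.E * D.E.factorial) : ℕ) : ℂ)⁻¹

/-- `e` is a `+-` edge that separates the first `k` external legs from the last `l`:
one end `u` of `e` is a `+` vertex, the other end `v` is a `-` vertex, and removing `e` disconnects
the diagram in such a way that the first `k` legs stay with `u` and the last `l` with `v`. -/
def Separates {k l : ℕ} (D : Diagram (k + l)) (e : Fin D.E) : Prop :=
  ∃ u v, ((u = D.src e ∧ v = D.tgt e) ∨ (u = D.tgt e ∧ v = D.src e)) ∧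
    D.sgn u = 1 ∧ D.sgn v = -1 ∧
    ¬ D.Linked {e}ᶜ u v ∧
    (∀ i : Fin k, D.Linked {e}ᶜ u (D.leg (Fin.castAdd l i))) ∧
    (∀ j : Fin l, D.Linked {e}ᶜ v (D.leg (Fin.natAdd k j)))

end Diagram

/-- The data of a perturbative theory of one kind of particles. An energy-momentum is a pair
`q = (ω, 𝐩)` in `Ω × K`: for instance `Ω = ℝ` and `K = ℝᵈ` with Lebesgue measure, or lattices with
counting measure for a system in a box.

* `disp` is the dispersion law.
* `prop a b` describes the propagator `G_{ab}`. For `a = b` it is the function `G_{ab}` itself;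
  for `a ≠ b` the propagator is on shell and `prop a b` is the coefficient in front of the
  delta function of the mass shell (see `Theory.shellMeasure`). Reversing an edge does not change
  its propagator: `G_{ab}(q) = G_{ba}(-q)`.
* A vertex of type `ε` and order `j` in the coupling constant, with incoming momenta `p₁, …, p_m`,
  contributes `delta (p₁ + ⋯ + p_m) * vertex ε j {p₁, …, p_m}`, where `delta` is the factor
  responsible for the conservation of energy-momentum: the Kronecker delta when momenta are
  discrete, a nascent delta function (the Fourier transform of a space-time cut-off of the
  interaction) when they are continuous. Terms of degree `2` (counterterms) are allowed.
* `maxDeg j` bounds the degree in the fields of the interaction terms of order `j`. -/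
structure Theory (Ω K : Type*) [AddCommGroup Ω] [AddCommGroup K] [MeasureSpace Ω]
    [MeasureSpace K] where
  disp : K → Ω
  measurable_disp : Measurable disp
  prop : ℤˣ → ℤˣ → Ω × K → ℂ
  prop_symm : ∀ a b q, prop a b q = prop b a (-q)
  delta : Ω × K → ℂ
  vertex : ℤˣ → ℕ → Multiset (Ω × K) → ℂ
  maxDeg : ℕ → ℕ

namespace Theory

variable {Ω K : Type*} [AddCommGroup Ω] [AddCommGroup K] [MeasureSpace Ω] [MeasureSpace K]
variable (T : Theory Ω K)

/-- The mass shell: the momenta `(ω(𝐩), 𝐩)` and their negatives. -/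
def shell : Set (Ω × K) :=
  {q | q.1 = T.disp q.2 ∨ -q.1 = T.disp (-q.2)}

/-- The measure `δ(ω - ω(𝐩)) dω d𝐩 + δ(ω + ω(-𝐩)) dω d𝐩` on the mass shell. -/
def shellMeasure : Measure (Ω × K) :=
  Measure.map (fun k => (T.disp k, k)) volume + Measure.map (fun k => (-T.disp k, -k)) volume

/-- The measure against which `prop a b` is integrated: `G_{ab}(q) dq` is
`prop a b q ∂(propMeasure a b)`. -/
def propMeasure (a b : ℤˣ) : Measure (Ω × K) :=
  if a = b then volume else T.shellMeasure

/-- The integrand of a diagram (with amputated external legs), as a function of the momenta `q` of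
the internal edges. -/
def integrand {n : ℕ} (D : Diagram n) (p : Fin n → Ω × K) (q : Fin D.E → Ω × K) : ℂ :=
  (∏ e, T.prop (D.sgn (D.src e)) (D.sgn (D.tgt e)) (q e)) *
    ∏ v, (T.delta (D.incoming p q v).sum * T.vertex (D.sgn v) (D.ord v) (D.incoming p q v))

/-- The product of the measures belonging to the propagators of the edges. -/
def edgeMeasure {n : ℕ} (D : Diagram n) : Measure (Fin D.E → Ω × K) :=
  Measure.pi fun e => T.propMeasure (D.sgn (D.src e)) (D.sgn (D.tgt e))

/-- The contribution of a diagram, symmetry factor included. -/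
def contribution {n : ℕ} (D : Diagram n) (p : Fin n → Ω × K) : ℂ :=
  D.weight * ∫ q, T.integrand D p q ∂(T.edgeMeasure D)

/-- The diagrams of order `N` in the coupling constant for the connected amputated GGreen function
with external signs `ε`: the `i`-th leg is attached to a vertex of type `ε i`. -/
def diagrams {n : ℕ} (N : ℕ) (ε : Fin n → ℤˣ) : Set (Diagram n) :=
  {D | D.IsConnected ∧ (∀ i, D.sgn (D.leg i) = ε i) ∧ (∀ v, 1 ≤ D.ord v) ∧ ∑ v, D.ord v = N ∧
    ∀ v, D.degree v ≤ T.maxDeg (D.ord v)}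

/-- There are finitely many diagrams of each order, so the finite sums `∑ᶠ` below are genuine. -/
theorem diagrams_finite {n : ℕ} (N : ℕ) (ε : Fin n → ℤˣ) : (T.diagrams N ε).Finite := by
  classical
  set B := N * ∑ j ∈ Finset.range (N + 1), T.maxDeg j with hB
  let F : (Σ V : Fin (N + 1), Σ E : Fin (B + 1), (Fin E → Fin V) × (Fin E → Fin V) ×
      (Fin n → Fin V) × (Fin V → ℤˣ) × (Fin V → Fin (N + 1))) → Diagram n := fun x =>
    ⟨x.1, x.2.1, x.2.2.1, x.2.2.2.1, x.2.2.2.2.1, x.2.2.2.2.2.1, fun v => x.2.2.2.2.2.2 v⟩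
  refine (Set.finite_range F).subset ?_
  rintro D ⟨-, -, h1, hN, hd⟩
  have hord : ∀ v, D.ord v ≤ N := fun v =>
    hN ▸ Finset.single_le_sum (fun i _ => Nat.zero_le (D.ord i)) (Finset.mem_univ v)
  have hV : D.V ≤ N := by
    have h : ∑ _v : Fin D.V, 1 ≤ ∑ v, D.ord v := Finset.sum_le_sum fun v _ => h1 v
    simpa [hN] using h
  have hE : D.E ≤ B := by
    have h2 : D.E = ∑ v, (Finset.univ.filter fun e => D.src e = v).card := by
      have := Finset.card_eq_sum_card_fiberwise (s := (Finset.univ : Finset (Fin D.E)))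
        (t := (Finset.univ : Finset (Fin D.V))) (f := D.src) (fun _ _ => by simp)
      simpa using this
    calc D.E = ∑ v, (Finset.univ.filter fun e => D.src e = v).card := h2
      _ ≤ ∑ _v : Fin D.V, ∑ j ∈ Finset.range (N + 1), T.maxDeg j := by
          refine Finset.sum_le_sum fun v _ => ?_
          have h3 := hd v
          have h4 : T.maxDeg (D.ord v) ≤ ∑ j ∈ Finset.range (N + 1), T.maxDeg j :=
            Finset.single_le_sum (f := T.maxDeg) (fun i _ => Nat.zero_le _)
              (Finset.mem_range.2 (Nat.lt_succ_of_le (hord v)))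
          unfold Diagram.degree at h3
          omega
      _ = D.V * ∑ j ∈ Finset.range (N + 1), T.maxDeg j := by simp
      _ ≤ B := Nat.mul_le_mul_right _ hV
  exact ⟨⟨⟨D.V, Nat.lt_succ_of_le hV⟩, ⟨D.E, Nat.lt_succ_of_le hE⟩, D.src, D.tgt, D.leg, D.sgn,
    fun v => ⟨D.ord v, Nat.lt_succ_of_le (hord v)⟩⟩, rfl⟩

/-- The term of order `N` in the coupling constant of the connected amputated GGreen function
`Ĝ_n(p₁, ε₁, …, p_n, ε_n)`. -/
def Ghat (N : ℕ) {n : ℕ} (p : Fin n → Ω × K) (ε : Fin n → ℤˣ) : ℂ :=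
  ∑ᶠ D ∈ T.diagrams N ε, T.contribution D p

/-- The sum of all diagrams of order `N` for `Ĝ_{k+l}` that contain a `+-` edge separating the
first `k` external legs from the last `l`. -/
def sepSum (N k l : ℕ) (p : Fin (k + l) → Ω × K) (ε : Fin (k + l) → ℤˣ) : ℂ :=
  ∑ᶠ D ∈ {D ∈ T.diagrams N ε | ∃ e, D.Separates e}, T.contribution D p

/-- The same sum, each diagram being taken once for each `+-` edge with that property. -/
def sepSumMarked (N k l : ℕ) (p : Fin (k + l) → Ω × K) (ε : Fin (k + l) → ℤˣ) : ℂ :=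
  ∑ᶠ D ∈ T.diagrams N ε, (Set.ncard {e | D.Separates e} : ℂ) * T.contribution D p

/-- There are no divergences: at on-shell external momenta every diagram is an absolutely
convergent integral. -/
def Convergent : Prop :=
  ∀ (n N : ℕ) (ε : Fin n → ℤˣ) (p : Fin n → Ω × K), (∀ i, p i ∈ T.shell) →
    ∀ D ∈ T.diagrams N ε, Integrable (T.integrand D p) (T.edgeMeasure D)

/-- The propagators already contain the physical dispersion law with the proper normalization, so
that on-shell lines receive no corrections: the on-shell amputated two-point function vanishes in
all orders. (Only the two-point function with one `+` leg and one `-` leg is needed.) -/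
def Renormalized : Prop :=
  ∀ N, ∀ q ∈ T.shell, ∀ q' ∈ T.shell, T.Ghat N ![q, q'] ![1, -1] = 0

end Theory

end GGreen

end

/-! Cutting a separating `+-` edge leaves two connected diagrams: one with the first `k` legs and a
new `+` leg of momentum `q`, the other with the last `l` legs and a new `-` leg of momentum `-q`.
Conversely, two such diagrams can be glued along their new legs. Orders add and degrees are
unchanged, and by Fubini the glued integral is the integral over `q` of the propagator times the two
smaller integrals (`Theory.integral_glue`).

Symmetry factors are handled by counting labelled diagrams. The labels on the first side can be
chosen in binomially many ways, and the cut edge is one of the remaining edges. By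
`labelWeight_mul_choose` the weight of the whole times these numbers is the product of the weights
of the parts times 1/2, and the 1/2 cancels the two orientations of the cut edge. This gives the
count of diagrams with a marked separating edge.

To count every diagram once, mark the first separating edge. The sides cut off by separating edges
are nested, so there is exactly one such edge (`existsUnique_first`), and the same argument gives
the integral with its first factor restricted to diagrams in which no edge separates the new leg
from the others. The diagrams left out are given by the same formula with `l = 1`, whose second
factor is the on-shell two-point function. In a renormalized theory it vanishes, so the restriction
can be dropped (`Theory.Convergent.restrictedGhat_eq_Ghat`).

Both counts run through one argument with a parameter `r`: the marked edge has to be the first one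
only if `r` holds. -/

namespace GGreen

/-- A diagram with `n` external legs whose vertices and edges are labelled by arbitrary types and
whose vertices have orders below `M`. -/
@[ext]
structure GenDiagram (n M : ℕ) (V E : Type) where
  src : E → V
  tgt : E → V
  leg : Fin n → V
  sgn : V → ℤˣ
  ord : V → Fin M

namespace GenDiagram

variable {n M k l : ℕ} {V E V' E' V₁ V₂ E₁ E₂ : Type}

instance [Finite V] [Finite E] : Finite (GenDiagram n M V E) :=
  Finite.of_injective
    (fun x : GenDiagram n M V E => (x.src, x.tgt, x.leg, x.sgn, x.ord))
    (fun x y h => by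
      simp only [Prod.mk.injEq] at h
      exact GenDiagram.ext h.1 h.2.1 h.2.2.1 h.2.2.2.1 h.2.2.2.2)

noncomputable instance [Finite V] [Finite E] : Fintype (GenDiagram n M V E) := Fintype.ofFinite _

/-- `u` and `v` can be joined by a path all of whose edges lie in `S`. -/
def Linked (x : GenDiagram n M V E) (S : Set E) (u v : V) : Prop :=
  Relation.EqvGen (fun a b => ∃ f ∈ S, x.src f = a ∧ x.tgt f = b) u v

theorem Linked.mem {x : GenDiagram n M V E} {S : Set E} {u v : V} (h : x.Linked S u v)
    {C : Set V} (hC : ∀ f ∈ S, x.src f ∈ C ↔ x.tgt f ∈ C) : u ∈ C ↔ v ∈ C := by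
  induction h with
  | rel a b h => obtain ⟨f, hf, rfl, rfl⟩ := h; exact hC f hf
  | refl a => rfl
  | symm a b _ ih => exact ih.symm
  | trans a b c _ _ ih₁ ih₂ => exact ih₁.trans ih₂

theorem linked_edge (x : GenDiagram n M V E) {S : Set E} {f : E} (hf : f ∈ S) :
    x.Linked S (x.src f) (x.tgt f) :=
  Relation.EqvGen.rel _ _ ⟨f, hf, rfl, rfl⟩

theorem linked_edge_iff (x : GenDiagram n M V E) {S : Set E} {f : E} (hf : f ∈ S) (u : V) :
    x.Linked S u (x.src f) ↔ x.Linked S u (x.tgt f) :=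
  ⟨fun h => h.trans _ _ _ (x.linked_edge hf), fun h => h.trans _ _ _ ((x.linked_edge hf).symm _ _)⟩

/-- The diagram is non-empty and connected. -/
def IsConnected (x : GenDiagram n M V E) : Prop :=
  Nonempty V ∧ ∀ u v, x.Linked Set.univ u v

/-- Connectedness in the form used below: a non-empty set of vertices that no edge leaves is
everything. This replaces the handling of paths. -/
theorem isConnected_iff (x : GenDiagram n M V E) :
    x.IsConnected ↔ Nonempty V ∧
      ∀ C : Set V, (∀ f, x.src f ∈ C ↔ x.tgt f ∈ C) → ∀ u v, u ∈ C → v ∈ C := by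
  refine and_congr_right fun _ => ⟨fun h C hC u v => ((h u v).mem fun f _ => hC f).1,
    fun h u v => ?_⟩
  exact h {w | x.Linked Set.univ u w} (fun f => x.linked_edge_iff (Set.mem_univ f) u) u v
    (Relation.EqvGen.refl u)

theorem IsConnected.mem_of_mem {x : GenDiagram n M V E} (h : x.IsConnected) {C : Set V}
    (hC : ∀ f, x.src f ∈ C ↔ x.tgt f ∈ C) {u : V} (hu : u ∈ C) (v : V) : v ∈ C :=
  (x.isConnected_iff.1 h).2 C hC u v hu

open Classical in
/-- The multiset `{a}` if `c` holds, the empty one otherwise. -/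
noncomputable def singletonIf {P : Type*} (c : Prop) (a : P) : Multiset P :=
  if c then {a} else 0

@[simp]
theorem singletonIf_false {P : Type*} (a : P) : singletonIf False a = 0 := if_neg not_false

/-- The momenta flowing into the vertex `v`. -/
noncomputable def incoming [Fintype E] {P : Type*} [AddCommGroup P] (x : GenDiagram n M V E)
    (p : Fin n → P) (q : E → P) (v : V) : Multiset P :=
  (∑ i, singletonIf (x.leg i = v) (p i)) + (∑ e, singletonIf (x.src e = v) (q e))
    + ∑ e, singletonIf (x.tgt e = v) (-q e)

/-- The number of lines that meet at `v`. -/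
noncomputable def degree [Fintype E] (x : GenDiagram n M V E) (v : V) : ℕ :=
  (x.incoming (0 : Fin n → ℤ) 0 v).card

/-- The diagrams of order `N` with external signs `ε` and vertices of order `j` of degree at most
`d j`. -/
structure IsGood [Fintype V] [Fintype E] (x : GenDiagram n M V E) (d : ℕ → ℕ) (N : ℕ)
    (ε : Fin n → ℤˣ) : Prop where
  conn : x.IsConnected
  sgn_leg : ∀ i, x.sgn (x.leg i) = ε i
  one_le_ord : ∀ v, 1 ≤ (x.ord v : ℕ)
  sum_ord : ∑ v, (x.ord v : ℕ) = N
  degree_le : ∀ v, x.degree v ≤ d (x.ord v)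

/-- `A` is the side of the first `k` legs and of the `+` end of `e` in a partition of the vertices
such that `e` is the only edge between the two parts. -/
structure IsCut (x : GenDiagram (k + l) M V E) (e : E) (A : Set V) : Prop where
  closed : ∀ f, f ≠ e → (x.src f ∈ A ↔ x.tgt f ∈ A)
  ends : (x.src e ∈ A ∧ x.tgt e ∉ A ∧ x.sgn (x.src e) = 1 ∧ x.sgn (x.tgt e) = -1) ∨
    (x.tgt e ∈ A ∧ x.src e ∉ A ∧ x.sgn (x.tgt e) = 1 ∧ x.sgn (x.src e) = -1)
  left : ∀ i : Fin k, x.leg (Fin.castAdd l i) ∈ A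
  right : ∀ j : Fin l, x.leg (Fin.natAdd k j) ∉ A

/-- The edge `e` separates the first `k` legs from the last `l`. -/
def HasCut (x : GenDiagram (k + l) M V E) (e : E) : Prop := ∃ A, x.IsCut e A

/-- Removing one edge leaves only the components of its two ends. -/
theorem IsConnected.linked_or {x : GenDiagram n M V E} (h : x.IsConnected) (e : E) (w : V) :
    x.Linked {e}ᶜ (x.src e) w ∨ x.Linked {e}ᶜ (x.tgt e) w := by
  refine h.mem_of_mem (C := {w | x.Linked {e}ᶜ (x.src e) w ∨ x.Linked {e}ᶜ (x.tgt e) w})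
    (fun f => ?_) (u := x.src e) (Or.inl (Relation.EqvGen.refl _)) w
  by_cases hf : f = e
  · subst hf
    exact ⟨fun _ => Or.inr (Relation.EqvGen.refl _), fun _ => Or.inl (Relation.EqvGen.refl _)⟩
  · exact or_congr (x.linked_edge_iff hf _) (x.linked_edge_iff hf _)

/-- A cut only asks for a set `A` that no other edge leaves. By `linked_or` every leg is linked to
one of the ends of `e`, and it cannot be linked to the end on the other side of `A`. -/
theorem hasCut_iff {x : GenDiagram (k + l) M V E} (hx : x.IsConnected) (e : E) :
    x.HasCut e ↔ ∃ u v, ((u = x.src e ∧ v = x.tgt e) ∨ (u = x.tgt e ∧ v = x.src e)) ∧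
      x.sgn u = 1 ∧ x.sgn v = -1 ∧ ¬ x.Linked {e}ᶜ u v ∧
      (∀ i : Fin k, x.Linked {e}ᶜ u (x.leg (Fin.castAdd l i))) ∧
      (∀ j : Fin l, x.Linked {e}ᶜ v (x.leg (Fin.natAdd k j))) := by
  constructor
  · rintro ⟨A, hA⟩
    have hC : ∀ f ∈ ({e}ᶜ : Set E), x.src f ∈ A ↔ x.tgt f ∈ A := fun f hf => hA.closed f hf
    rcases hA.ends with ⟨h1, h2, h3, h4⟩ | ⟨h1, h2, h3, h4⟩
    · refine ⟨_, _, Or.inl ⟨rfl, rfl⟩, h3, h4, fun h => h2 ((h.mem hC).1 h1),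
        fun i => ?_, fun j => ?_⟩
      · exact (hx.linked_or e _).resolve_right fun h => h2 ((h.mem hC).2 (hA.left i))
      · exact (hx.linked_or e _).resolve_left fun h => hA.right j ((h.mem hC).1 h1)
    · refine ⟨_, _, Or.inr ⟨rfl, rfl⟩, h3, h4, fun h => h2 ((h.mem hC).1 h1),
        fun i => ?_, fun j => ?_⟩
      · exact (hx.linked_or e _).resolve_left fun h => h2 ((h.mem hC).2 (hA.left i))
      · exact (hx.linked_or e _).resolve_right fun h => hA.right j ((h.mem hC).1 h1)
  · rintro ⟨u, v, h, hu, hv, huv, hk, hl⟩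
    refine ⟨{w | x.Linked {e}ᶜ u w}, fun f hf => x.linked_edge_iff hf u, ?_, hk, fun j h => ?_⟩
    · rcases h with ⟨rfl, rfl⟩ | ⟨rfl, rfl⟩
      · exact Or.inl ⟨Relation.EqvGen.refl _, huv, hu, hv⟩
      · exact Or.inr ⟨Relation.EqvGen.refl _, huv, hu, hv⟩
    · exact huv (h.trans _ _ _ ((hl j).symm _ _))

/-- The signs decide which end of `e` lies in the side, so two cuts at `e` contain the same end; by
`linked_or` each vertex of `A` is linked to that end. -/
theorem IsCut.subset {x : GenDiagram (k + l) M V E} (hx : x.IsConnected) {e : E} {A A' : Set V}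
    (h : x.IsCut e A) (h' : x.IsCut e A') : A ⊆ A' := by
  intro w hw
  have hC : ∀ f ∈ ({e}ᶜ : Set E), x.src f ∈ A ↔ x.tgt f ∈ A := fun f hf => h.closed f hf
  have hC' : ∀ f ∈ ({e}ᶜ : Set E), x.src f ∈ A' ↔ x.tgt f ∈ A' := fun f hf => h'.closed f hf
  rcases h.ends with ⟨h1, h2, h3, h4⟩ | ⟨h1, h2, h3, h4⟩
  · rcases h'.ends with ⟨h1', h2', h3', h4'⟩ | ⟨h1', h2', h3', h4'⟩
    · exact (((hx.linked_or e w).resolve_right fun h => h2 ((h.mem hC).2 hw)).mem hC').1 h1'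
    · rw [h3] at h4'; exact absurd h4' (by decide)
  · rcases h'.ends with ⟨h1', h2', h3', h4'⟩ | ⟨h1', h2', h3', h4'⟩
    · rw [h3] at h4'; exact absurd h4' (by decide)
    · exact (((hx.linked_or e w).resolve_left fun h => h2 ((h.mem hC).2 hw)).mem hC').1 h1'

theorem IsCut.unique {x : GenDiagram (k + l) M V E} (hx : x.IsConnected) {e : E} {A A' : Set V}
    (h : x.IsCut e A) (h' : x.IsCut e A') : A = A' :=
  (h.subset hx h').antisymm (h'.subset hx h)

/-- If `r` holds, the side `A` of a cut contains no separating edge. -/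
def IsFirst (r : Prop) (x : GenDiagram (k + l) M V E) (A : Set V) : Prop :=
  r → ∀ f, x.HasCut f → ¬ (x.src f ∈ A ∧ x.tgt f ∈ A)

/-- A separating edge inside the side `A` of a cut cuts off a smaller side. -/
theorem IsCut.ssubset {x : GenDiagram (k + l) M V E} (hx : x.IsConnected) (hl : 1 ≤ l)
    {e f : E} {A B : Set V} (hA : x.IsCut e A) (hB : x.IsCut f B)
    (hf : x.src f ∈ A ∧ x.tgt f ∈ A) : B ⊂ A := by
  have hfe : e ≠ f := by
    rintro rfl
    rcases hA.ends with h | h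
    · exact h.2.1 hf.2
    · exact h.2.1 hf.1
  have key : B ⊆ A := by
    intro w hwB
    by_contra hwA
    have hclosed : ∀ g, g ≠ e → g ≠ f →
        ((x.src g ∈ A ↔ x.tgt g ∈ A) ∧ (x.src g ∈ B ↔ x.tgt g ∈ B)) :=
      fun g h1 h2 => ⟨hA.closed g h1, hB.closed g h2⟩
    have hleg := hA.right ⟨0, hl⟩
    have hleg' := hB.right ⟨0, hl⟩
    have hends := hA.ends
    have heB := hB.closed e hfe
    by_cases hv : x.src e ∈ B
    -- Both ends of `e` lie in `B` and both ends of `f` in `A`, so no edge leaves the complement of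
    -- `A ∪ B`. As it contains a right leg, it would be everything.
    · have := hx.mem_of_mem (C := {w | w ∉ A ∧ w ∉ B}) (fun g => by
        rcases eq_or_ne g e with rfl | h1
        · simp only [Set.mem_ofPred_eq]; tauto
        rcases eq_or_ne g f with rfl | h2
        · simp only [Set.mem_ofPred_eq]; tauto
        have := hclosed g h1 h2
        simp only [Set.mem_ofPred_eq]; tauto) ⟨hleg, hleg'⟩ w
      exact this.2 hwB
    -- Both ends of `e` lie outside `B`: now no edge leaves `B \ A`, which would therefore contain a
    -- right leg.
    · have := hx.mem_of_mem (C := {w | w ∉ A ∧ w ∈ B}) (fun g => by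
        rcases eq_or_ne g e with rfl | h1
        · simp only [Set.mem_ofPred_eq]; tauto
        rcases eq_or_ne g f with rfl | h2
        · simp only [Set.mem_ofPred_eq]; tauto
        have := hclosed g h1 h2
        simp only [Set.mem_ofPred_eq]; tauto) ⟨hwA, hwB⟩ (x.leg (Fin.natAdd k ⟨0, hl⟩))
      exact hleg' this.2
  refine ⟨key, fun h => ?_⟩
  rcases hB.ends with h' | h'
  · exact h'.2.1 (h hf.2)
  · exact h'.2.1 (h hf.1)

/-- Of two separating edges one lies on the side cut off by the other. -/
theorem IsCut.inside_or_inside {x : GenDiagram (k + l) M V E} (hx : x.IsConnected) (hk : 1 ≤ k)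
    {e f : E} {A B : Set V} (hA : x.IsCut e A) (hB : x.IsCut f B) (hef : e ≠ f) :
    (x.src f ∈ A ∧ x.tgt f ∈ A) ∨ (x.src e ∈ B ∧ x.tgt e ∈ B) := by
  by_contra! hcon
  obtain ⟨hf, he⟩ := hcon
  have hfA := hA.closed f hef.symm
  have heB := hB.closed e hef
  have hclosed : ∀ g, g ≠ e → g ≠ f →
      ((x.src g ∈ A ↔ x.tgt g ∈ A) ∧ (x.src g ∈ B ↔ x.tgt g ∈ B)) :=
    fun g h1 h2 => ⟨hA.closed g h1, hB.closed g h2⟩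
  have hleg := hA.left ⟨0, hk⟩
  have hleg' := hB.left ⟨0, hk⟩
  have hends := hA.ends
  -- Here `e` lies outside `B` and `f` is not inside `A`, so no edge leaves `A ∩ B`. As it contains
  -- a left leg, it would be everything.
  have := hx.mem_of_mem (C := {w | w ∈ A ∧ w ∈ B}) (fun g => by
    rcases eq_or_ne g e with rfl | h1
    · simp only [Set.mem_ofPred_eq]; tauto
    rcases eq_or_ne g f with rfl | h2
    · simp only [Set.mem_ofPred_eq]; tauto
    have := hclosed g h1 h2
    simp only [Set.mem_ofPred_eq]; tauto) ⟨hleg, hleg'⟩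
  exact he (this _).2 (this _).2

/-- If there are separating edges, exactly one of them is the first. -/
theorem existsUnique_first [Finite V] {x : GenDiagram (k + l) M V E} (hx : x.IsConnected)
    (hk : 1 ≤ k) (hl : 1 ≤ l) (h : ∃ e, x.HasCut e) :
    ∃! e, ∃ A, x.IsCut e A ∧ x.IsFirst True A := by
  -- The first separating edge is one with a minimal side: by `ssubset`, a separating edge inside
  -- that side would cut off a smaller one.
  obtain ⟨A, ⟨e, hA⟩, hmin⟩ := (wellFounded_lt (α := Set V)).has_min
    {A | ∃ e, x.IsCut e A} (let ⟨e, A, hA⟩ := h; ⟨A, e, hA⟩)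
  refine ⟨e, ⟨A, hA, fun _ f ⟨B, hB⟩ hf => hmin B ⟨f, hB⟩ (hA.ssubset hx hl hB hf)⟩, ?_⟩
  rintro f ⟨B, hB, hBf⟩
  by_contra hne
  rcases hA.inside_or_inside hx hk hB (Ne.symm hne) with h' | h'
  · exact hmin B ⟨f, hB⟩ (hA.ssubset hx hl hB h')
  · exact hBf trivial e ⟨A, hA⟩ h'

end GenDiagram

end GGreen

/-! ### Relabelling diagrams and gluing two diagrams along an edge -/

namespace GGreen

namespace GenDiagram

variable {n M k l : ℕ} {V E V' E' V₁ V₂ E₁ E₂ : Type}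

/-- Relabelling the vertices and the edges. -/
def relabel (σ : V ≃ V') (τ : E ≃ E') (x : GenDiagram n M V E) : GenDiagram n M V' E' where
  src f := σ (x.src (τ.symm f))
  tgt f := σ (x.tgt (τ.symm f))
  leg i := σ (x.leg i)
  sgn v := x.sgn (σ.symm v)
  ord v := x.ord (σ.symm v)

@[simp]
theorem relabel_symm_relabel (σ : V ≃ V') (τ : E ≃ E') (x : GenDiagram n M V E) :
    (x.relabel σ τ).relabel σ.symm τ.symm = x := by
  simp [relabel]

/-- Relabelling as an equivalence. -/
def relabelEquiv (σ : V ≃ V') (τ : E ≃ E') : GenDiagram n M V E ≃ GenDiagram n M V' E' where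
  toFun := relabel σ τ
  invFun := relabel σ.symm τ.symm
  left_inv x := x.relabel_symm_relabel σ τ
  right_inv x := x.relabel_symm_relabel σ.symm τ.symm

theorem incoming_relabel [Fintype E] [Fintype E'] {P : Type*} [AddCommGroup P] (σ : V ≃ V')
    (τ : E ≃ E') (x : GenDiagram n M V E) (p : Fin n → P) (q : E' → P) (v : V) :
    (x.relabel σ τ).incoming p q (σ v) = x.incoming p (fun f => q (τ f)) v := by
  unfold incoming relabel
  simp only [EmbeddingLike.apply_eq_iff_eq]
  refine congrArg₂ (· + ·) (congrArg₂ (· + ·) rfl ?_) ?_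
  · exact Fintype.sum_equiv τ.symm _ _ fun f => by simp
  · exact Fintype.sum_equiv τ.symm _ _ fun f => by simp

theorem IsConnected.relabel {x : GenDiagram n M V E} (hx : x.IsConnected) (σ : V ≃ V')
    (τ : E ≃ E') : (x.relabel σ τ).IsConnected := by
  refine (isConnected_iff _).2 ⟨σ.nonempty_congr.1 hx.1, fun C hC u v hu => ?_⟩
  have := hx.mem_of_mem (C := σ ⁻¹' C) (fun f => by simpa [GenDiagram.relabel] using hC (τ f))
    (u := σ.symm u) (by simpa using hu) (σ.symm v)
  simpa using this

theorem IsGood.relabel [Fintype V] [Fintype E] [Fintype V'] [Fintype E'] {d : ℕ → ℕ} {N : ℕ}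
    {ε : Fin n → ℤˣ} {x : GenDiagram n M V E} (hx : x.IsGood d N ε) (σ : V ≃ V') (τ : E ≃ E') :
    (x.relabel σ τ).IsGood d N ε where
  conn := hx.conn.relabel σ τ
  sgn_leg i := by simpa [GenDiagram.relabel] using hx.sgn_leg i
  one_le_ord v := hx.one_le_ord _
  sum_ord := by
    rw [← hx.sum_ord]
    exact Fintype.sum_equiv σ.symm _ _ fun v => rfl
  degree_le v := by
    obtain ⟨v, rfl⟩ := σ.surjective v
    have := hx.degree_le v
    unfold degree at this ⊢
    rw [incoming_relabel]
    simpa [GenDiagram.relabel, Pi.zero_def] using this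

theorem isGood_relabel [Fintype V] [Fintype E] [Fintype V'] [Fintype E'] {d : ℕ → ℕ} {N : ℕ}
    {ε : Fin n → ℤˣ} {x : GenDiagram n M V E} (σ : V ≃ V') (τ : E ≃ E') :
    (x.relabel σ τ).IsGood d N ε ↔ x.IsGood d N ε :=
  ⟨fun h => by simpa using h.relabel σ.symm τ.symm, fun h => h.relabel σ τ⟩

theorem isCut_relabel (x : GenDiagram (k + l) M V E) (σ : V ≃ V') (τ : E ≃ E') (e : E')
    (A : Set V') : (x.relabel σ τ).IsCut e A ↔ x.IsCut (τ.symm e) (σ ⁻¹' A) := by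
  constructor
  · rintro ⟨h1, h2, h3, h4⟩
    refine ⟨fun f hf => ?_, by simpa [relabel] using h2, h3, h4⟩
    simpa [relabel] using h1 (τ f) (fun h => hf (by simp [← h]))
  · rintro ⟨h1, h2, h3, h4⟩
    refine ⟨fun f hf => ?_, by simpa [relabel] using h2, h3, h4⟩
    simpa [relabel] using h1 (τ.symm f) (fun h => hf (τ.symm.injective h))

theorem hasCut_relabel (x : GenDiagram (k + l) M V E) (σ : V ≃ V') (τ : E ≃ E') (e : E') :
    (x.relabel σ τ).HasCut e ↔ x.HasCut (τ.symm e) := by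
  constructor
  · rintro ⟨A, hA⟩
    exact ⟨_, (isCut_relabel x σ τ e A).1 hA⟩
  · rintro ⟨A, hA⟩
    refine ⟨σ.symm ⁻¹' A, (isCut_relabel x σ τ e _).2 ?_⟩
    simpa [← Set.preimage_comp] using hA

theorem isFirst_relabel (r : Prop) (x : GenDiagram (k + l) M V E) (σ : V ≃ V') (τ : E ≃ E')
    (A : Set V') : (x.relabel σ τ).IsFirst r A ↔ x.IsFirst r (σ ⁻¹' A) := by
  unfold IsFirst
  refine imp_congr_right fun _ => ?_
  rw [← τ.symm.forall_congr_right]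
  refine forall_congr' fun f => ?_
  rw [hasCut_relabel]
  rfl

/-- The diagram obtained by joining the last legs of `y` and `z` to an edge. The Boolean variable
tells whether that edge starts or ends in `y`. -/
def glue (y : GenDiagram (k + 1) M V₁ E₁) (z : GenDiagram (l + 1) M V₂ E₂) (o : Bool) :
    GenDiagram (k + l) M (V₁ ⊕ V₂) ((E₁ ⊕ E₂) ⊕ Unit) where
  src := Sum.elim (Sum.map y.src z.src) fun _ =>
    if o then Sum.inl (y.leg (Fin.last k)) else Sum.inr (z.leg (Fin.last l))
  tgt := Sum.elim (Sum.map y.tgt z.tgt) fun _ =>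
    if o then Sum.inr (z.leg (Fin.last l)) else Sum.inl (y.leg (Fin.last k))
  leg := Fin.append (fun i => Sum.inl (y.leg i.castSucc)) fun j => Sum.inr (z.leg j.castSucc)
  sgn := Sum.elim y.sgn z.sgn
  ord := Sum.elim y.ord z.ord

theorem glue_leg_left (y : GenDiagram (k + 1) M V₁ E₁) (z : GenDiagram (l + 1) M V₂ E₂)
    (o : Bool) (i : Fin k) : (glue y z o).leg (Fin.castAdd l i) = Sum.inl (y.leg i.castSucc) := by
  simp [glue]

theorem glue_leg_right (y : GenDiagram (k + 1) M V₁ E₁) (z : GenDiagram (l + 1) M V₂ E₂)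
    (o : Bool) (j : Fin l) : (glue y z o).leg (Fin.natAdd k j) = Sum.inr (z.leg j.castSucc) := by
  simp [glue]

/-- For the vertices of `y` the joining edge acts as the last leg. It brings its momentum into its
source, which lies in `y` exactly if `o = true`, and the negative into its target. -/
theorem incoming_glue_inl [Fintype E₁] [Fintype E₂] {P : Type*} [AddCommGroup P]
    (y : GenDiagram (k + 1) M V₁ E₁) (z : GenDiagram (l + 1) M V₂ E₂) (o : Bool)
    (p : Fin k → P) (p' : Fin l → P) (q : (E₁ ⊕ E₂) ⊕ Unit → P) (v : V₁) :
    (glue y z o).incoming (Fin.append p p') q (Sum.inl v) =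
      y.incoming (Fin.snoc p (if o then q (Sum.inr ()) else -q (Sum.inr ())) : Fin (k + 1) → P)
        (fun f => q (Sum.inl (Sum.inl f))) v := by
  unfold incoming glue
  simp only [Fin.sum_univ_add, Fintype.sum_sum_type, Fin.sum_univ_castSucc]
  cases o <;> simp <;> abel

theorem incoming_glue_inr [Fintype E₁] [Fintype E₂] {P : Type*} [AddCommGroup P]
    (y : GenDiagram (k + 1) M V₁ E₁) (z : GenDiagram (l + 1) M V₂ E₂) (o : Bool)
    (p : Fin k → P) (p' : Fin l → P) (q : (E₁ ⊕ E₂) ⊕ Unit → P) (v : V₂) :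
    (glue y z o).incoming (Fin.append p p') q (Sum.inr v) =
      z.incoming (Fin.snoc p' (if o then -q (Sum.inr ()) else q (Sum.inr ())) : Fin (l + 1) → P)
        (fun f => q (Sum.inl (Sum.inr f))) v := by
  unfold incoming glue
  simp only [Fin.sum_univ_add, Fintype.sum_sum_type, Fin.sum_univ_castSucc]
  cases o <;> simp <;> abel

/-- The degree counts incoming momenta, so this is `incoming_glue_inl` with all momenta zero. -/
theorem degree_glue_inl [Fintype E₁] [Fintype E₂] (y : GenDiagram (k + 1) M V₁ E₁)
    (z : GenDiagram (l + 1) M V₂ E₂) (o : Bool) (v : V₁) :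
    (glue y z o).degree (Sum.inl v) = y.degree v := by
  have h := incoming_glue_inl y z o (0 : Fin k → ℤ) 0 0 v
  have h1 : (Fin.append 0 0 : Fin (k + l) → ℤ) = 0 := by
    ext i; refine Fin.addCases (fun i => ?_) (fun i => ?_) i <;> simp
  have h2 : (Fin.snoc (0 : Fin k → ℤ) 0 : Fin (k + 1) → ℤ) = 0 := by
    ext i; refine Fin.lastCases ?_ (fun i => ?_) i <;> simp
  simp only [h1, Pi.zero_apply, neg_zero, ite_self, h2] at h
  exact congrArg Multiset.card h

theorem degree_glue_inr [Fintype E₁] [Fintype E₂] (y : GenDiagram (k + 1) M V₁ E₁)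
    (z : GenDiagram (l + 1) M V₂ E₂) (o : Bool) (v : V₂) :
    (glue y z o).degree (Sum.inr v) = z.degree v := by
  have h := incoming_glue_inr y z o (0 : Fin k → ℤ) 0 0 v
  have h1 : (Fin.append 0 0 : Fin (k + l) → ℤ) = 0 := by
    ext i; refine Fin.addCases (fun i => ?_) (fun i => ?_) i <;> simp
  have h2 : (Fin.snoc (0 : Fin l → ℤ) 0 : Fin (l + 1) → ℤ) = 0 := by
    ext i; refine Fin.lastCases ?_ (fun i => ?_) i <;> simp
  simp only [h1, Pi.zero_apply, neg_zero, ite_self, h2] at h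
  exact congrArg Multiset.card h

theorem isConnected_glue (y : GenDiagram (k + 1) M V₁ E₁) (z : GenDiagram (l + 1) M V₂ E₂)
    (o : Bool) : (glue y z o).IsConnected ↔ y.IsConnected ∧ z.IsConnected := by
  constructor
  · intro h
    constructor
    · refine (isConnected_iff y).2 ⟨⟨y.leg (Fin.last k)⟩, fun C hC u v hu => ?_⟩
      -- A closed set in `y` is extended by all or nothing of `z`, according to whether it contains
      -- the end of the joining edge, so that this edge does not leave it either.
      by_cases hl : y.leg (Fin.last k) ∈ C
      · have := h.mem_of_mem (C := Sum.elim C fun _ => True) (fun f => by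
          rcases f with (f | f) | f
          · exact hC f
          · exact Iff.rfl
          · cases o
            · exact ⟨fun _ => hl, fun _ => trivial⟩
            · exact ⟨fun _ => trivial, fun _ => hl⟩) (u := Sum.inl u) hu (Sum.inl v)
        exact this
      · have := h.mem_of_mem (C := Sum.elim C fun _ => False) (fun f => by
          rcases f with (f | f) | f
          · exact hC f
          · exact Iff.rfl
          · cases o
            · exact ⟨fun h => h.elim, fun h => hl h⟩
            · exact ⟨fun h => hl h, fun h => h.elim⟩) (u := Sum.inl u) hu (Sum.inl v)
        exact this
    · refine (isConnected_iff z).2 ⟨⟨z.leg (Fin.last l)⟩, fun C hC u v hu => ?_⟩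
      by_cases hl : z.leg (Fin.last l) ∈ C
      · have := h.mem_of_mem (C := Sum.elim (fun _ => True) C) (fun f => by
          rcases f with (f | f) | f
          · exact Iff.rfl
          · exact hC f
          · cases o
            · exact ⟨fun _ => trivial, fun _ => hl⟩
            · exact ⟨fun _ => hl, fun _ => trivial⟩) (u := Sum.inr u) hu (Sum.inr v)
        exact this
      · have := h.mem_of_mem (C := Sum.elim (fun _ => False) C) (fun f => by
          rcases f with (f | f) | f
          · exact Iff.rfl
          · exact hC f
          · cases o
            · exact ⟨fun h => hl h, fun h => h.elim⟩
            · exact ⟨fun h => h.elim, fun h => hl h⟩) (u := Sum.inr u) hu (Sum.inr v)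
        exact this
  · rintro ⟨hy, hz⟩
    refine (isConnected_iff _).2 ⟨⟨Sum.inl (y.leg (Fin.last k))⟩, fun C hC u v hu => ?_⟩
    have h1 : ∀ a b, Sum.inl a ∈ C → Sum.inl b ∈ C := fun a b ha =>
      hy.mem_of_mem (C := Sum.inl ⁻¹' C) (fun f => hC (Sum.inl (Sum.inl f))) ha b
    have h2 : ∀ a b, Sum.inr a ∈ C → Sum.inr b ∈ C := fun a b ha =>
      hz.mem_of_mem (C := Sum.inr ⁻¹' C) (fun f => hC (Sum.inl (Sum.inr f))) ha b
    have h3 : Sum.inl (y.leg (Fin.last k)) ∈ C ↔ Sum.inr (z.leg (Fin.last l)) ∈ C := by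
      have := hC (Sum.inr ())
      cases o
      · simpa [glue] using this.symm
      · simpa [glue] using this
    rcases u with u | u <;> rcases v with v | v
    · exact h1 _ _ hu
    · exact h2 _ _ (h3.1 (h1 _ _ hu))
    · exact h1 _ _ (h3.2 (h2 _ _ hu))
    · exact h2 _ _ hu

theorem isCut_glue (y : GenDiagram (k + 1) M V₁ E₁) (z : GenDiagram (l + 1) M V₂ E₂) (o : Bool) :
    (glue y z o).IsCut (Sum.inr ()) (Set.range Sum.inl) ↔
      y.sgn (y.leg (Fin.last k)) = 1 ∧ z.sgn (z.leg (Fin.last l)) = -1 := by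
  constructor
  · intro h
    have := h.ends
    cases o <;> simpa [glue] using this
  · intro h
    refine ⟨fun f hf => ?_, ?_, fun i => by simp [glue], fun j => by simp [glue]⟩
    · rcases f with (f | f) | f
      · simp [glue]
      · simp [glue]
      · exact absurd rfl hf
    · cases o <;> simpa [glue] using h

/-- The signs prescribed for the two new legs say that the joining edge is a `+-` edge with its `+`
end in `y`; the order of the whole splits into those of the parts, hence the antidiagonal. -/
theorem isGood_glue [Fintype V₁] [Fintype E₁] [Fintype V₂] [Fintype E₂]
    (y : GenDiagram (k + 1) M V₁ E₁) (z : GenDiagram (l + 1) M V₂ E₂) (o : Bool) (d : ℕ → ℕ)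
    (N : ℕ) (ε : Fin k → ℤˣ) (ε' : Fin l → ℤˣ) :
    ((glue y z o).IsGood d N (Fin.append ε ε') ∧
        (glue y z o).IsCut (Sum.inr ()) (Set.range Sum.inl)) ↔
      ∃ ab ∈ Finset.HasAntidiagonal.antidiagonal N, y.IsGood d ab.1 (Fin.snoc ε 1 : Fin (k + 1) → ℤˣ) ∧
        z.IsGood d ab.2 (Fin.snoc ε' (-1) : Fin (l + 1) → ℤˣ) := by
  rw [isCut_glue]
  constructor
  · rintro ⟨h, hy, hz⟩
    have hc := (isConnected_glue y z o).1 h.conn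
    refine ⟨(∑ v, (y.ord v : ℕ), ∑ v, (z.ord v : ℕ)), ?_, ⟨hc.1, ?_, ?_, rfl, ?_⟩,
      ⟨hc.2, ?_, ?_, rfl, ?_⟩⟩
    · simpa [glue] using h.sum_ord
    · refine Fin.lastCases (by simpa using hy) fun i => ?_
      simpa [glue] using h.sgn_leg (Fin.castAdd l i)
    · exact fun v => h.one_le_ord (Sum.inl v)
    · exact fun v => degree_glue_inl y z o v ▸ h.degree_le (Sum.inl v)
    · refine Fin.lastCases (by simpa using hz) fun i => ?_
      simpa [glue] using h.sgn_leg (Fin.natAdd k i)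
    · exact fun v => h.one_le_ord (Sum.inr v)
    · exact fun v => degree_glue_inr y z o v ▸ h.degree_le (Sum.inr v)
  · rintro ⟨⟨a, b⟩, hab, hy, hz⟩
    refine ⟨⟨(isConnected_glue y z o).2 ⟨hy.conn, hz.conn⟩, ?_, ?_, ?_, ?_⟩, ?_, ?_⟩
    · refine Fin.addCases (fun i => ?_) fun j => ?_
      · simpa [glue] using hy.sgn_leg i.castSucc
      · simpa [glue] using hz.sgn_leg j.castSucc
    · rintro (v | v)
      · exact hy.one_le_ord v
      · exact hz.one_le_ord v
    · have h1 := hy.sum_ord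
      have h2 := hz.sum_ord
      have := Finset.HasAntidiagonal.mem_antidiagonal.1 hab
      simp only at h1 h2 this
      simp [glue, h1, h2, this]
    · rintro (v | v)
      · rw [degree_glue_inl]; exact hy.degree_le v
      · rw [degree_glue_inr]; exact hz.degree_le v
    · simpa using hy.sgn_leg (Fin.last k)
    · simpa using hz.sgn_leg (Fin.last l)

/-- As `z` is connected and carries one of the last `l ≥ 1` legs, it lies entirely on the far side
of such a cut, where it plays the role of the last leg of `y`. -/
theorem hasCut_glue_inl (y : GenDiagram (k + 1) M V₁ E₁) (z : GenDiagram (l + 1) M V₂ E₂)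
    (o : Bool) (hl : 1 ≤ l) (hz : z.IsConnected) (f : E₁) :
    (glue y z o).HasCut (Sum.inl (Sum.inl f)) ↔ y.HasCut f := by
  constructor
  · rintro ⟨A, hA⟩
    have h2 : ∀ b, Sum.inr b ∉ A := fun b hb => by
      have := hz.mem_of_mem (C := Sum.inr ⁻¹' A)
        (fun f => hA.closed (Sum.inl (Sum.inr f)) (by simp)) hb (z.leg (Fin.castSucc ⟨0, hl⟩))
      refine hA.right ⟨0, hl⟩ ?_
      rw [glue_leg_right]
      exact this
    have h3 : Sum.inl (y.leg (Fin.last k)) ∉ A := by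
      have := hA.closed (Sum.inr ()) (by simp)
      cases o <;> simpa [glue, h2] using this
    refine ⟨Sum.inl ⁻¹' A, fun g hg => ?_, ?_, fun i => ?_, fun j => ?_⟩
    · exact hA.closed (Sum.inl (Sum.inl g)) (by simpa using hg)
    · simpa [glue] using hA.ends
    · have := hA.left i
      rwa [glue_leg_left] at this
    · rw [Subsingleton.elim j 0]; exact h3
  · rintro ⟨A, hA⟩
    have h3 : y.leg (Fin.last k) ∉ A := hA.right 0
    refine ⟨Sum.inl '' A, fun g hg => ?_, ?_, fun i => ?_, fun j => ?_⟩
    · rcases g with (g | g) | g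
      · simpa [glue] using hA.closed g (by simpa using hg)
      · simp [glue]
      · cases o <;> simpa [glue] using h3
    · simpa [glue] using hA.ends
    · rw [glue_leg_left]
      exact ⟨_, hA.left i, rfl⟩
    · simp [glue]

/-- Being first is a condition on `y` alone. Therefore the sum over pairs `y`, `z` still factorizes
when it is imposed. -/
theorem isFirst_glue (r : Prop) (y : GenDiagram (k + 1) M V₁ E₁) (z : GenDiagram (l + 1) M V₂ E₂)
    (o : Bool) (hl : 1 ≤ l) (hz : z.IsConnected) :
    (glue y z o).IsFirst r (Set.range Sum.inl) ↔ (r → ∀ f, ¬ y.HasCut f) := by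
  refine imp_congr_right fun _ => ⟨fun h f hf => ?_, fun h f hf => ?_⟩
  · exact h _ ((hasCut_glue_inl y z o hl hz f).2 hf) ⟨⟨_, rfl⟩, ⟨_, rfl⟩⟩
  · rcases f with (f | f) | f
    · exact absurd ((hasCut_glue_inl y z o hl hz f).1 hf) (h f)
    · simp [glue]
    · cases o <;> simp [glue]

theorem glue_injective : Function.Injective
    fun w : GenDiagram (k + 1) M V₁ E₁ × GenDiagram (l + 1) M V₂ E₂ × Bool =>
      glue w.1 w.2.1 w.2.2 := by
  rintro ⟨y, z, o⟩ ⟨y', z', o'⟩ h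
  have hsrc := fun f => congrFun (congrArg GenDiagram.src h) f
  have htgt := fun f => congrFun (congrArg GenDiagram.tgt h) f
  have hleg := fun f => congrFun (congrArg GenDiagram.leg h) f
  have hsgn := fun f => congrFun (congrArg GenDiagram.sgn h) f
  have hord := fun f => congrFun (congrArg GenDiagram.ord h) f
  have hs := hsrc (Sum.inr ())
  have ht := htgt (Sum.inr ())
  have ho : o = o' ∧ y.leg (Fin.last k) = y'.leg (Fin.last k) ∧
      z.leg (Fin.last l) = z'.leg (Fin.last l) := by
    clear h hsrc htgt hleg hsgn hord
    cases o <;> cases o' <;> simp_all [glue]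
  obtain ⟨rfl, hy, hz⟩ := ho
  have h1 : y = y' := by
    refine GenDiagram.ext ?_ ?_ ?_ ?_ ?_
    · funext f; simpa [glue] using hsrc (Sum.inl (Sum.inl f))
    · funext f; simpa [glue] using htgt (Sum.inl (Sum.inl f))
    · funext i
      refine Fin.lastCases hy (fun i => ?_) i
      simpa [glue] using hleg (Fin.castAdd l i)
    · funext v; exact hsgn (Sum.inl v)
    · funext v; exact hord (Sum.inl v)
  have h2 : z = z' := by
    refine GenDiagram.ext ?_ ?_ ?_ ?_ ?_
    · funext f; simpa [glue] using hsrc (Sum.inl (Sum.inr f))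
    · funext f; simpa [glue] using htgt (Sum.inl (Sum.inr f))
    · funext i
      refine Fin.lastCases hz (fun i => ?_) i
      simpa [glue] using hleg (Fin.natAdd k i)
    · funext v; exact hsgn (Sum.inr v)
    · funext v; exact hord (Sum.inr v)
  rw [h1, h2]

/-- The inverse of gluing. The cut puts both ends of an edge other than the marked one on the same
side, so `hsrc` determines the targets too; the orientation `o` is read off from the marked edge. -/
theorem exists_glue_eq (x : GenDiagram (k + l) M (V₁ ⊕ V₂) ((E₁ ⊕ E₂) ⊕ Unit))
    (hx : x.IsCut (Sum.inr ()) (Set.range Sum.inl))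
    (hsrc : ∀ f : E₁ ⊕ E₂, x.src (Sum.inl f) ∈ Set.range Sum.inl ↔ f.isLeft) :
    ∃ (y : GenDiagram (k + 1) M V₁ E₁) (z : GenDiagram (l + 1) M V₂ E₂) (o : Bool),
      glue y z o = x := by
  have htgt : ∀ f : E₁ ⊕ E₂, x.tgt (Sum.inl f) ∈ Set.range Sum.inl ↔ f.isLeft := fun f => by
    rw [← hx.closed (Sum.inl f) (by simp), hsrc]
  have hinr : ∀ v : V₁ ⊕ V₂, v ∉ Set.range Sum.inl → ∃ b, v = Sum.inr b := by
    rintro (v | v) hv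
    · exact absurd ⟨v, rfl⟩ hv
    · exact ⟨v, rfl⟩
  choose s₁ hs₁ using fun f : E₁ => (hsrc (Sum.inl f)).2 rfl
  choose t₁ ht₁ using fun f : E₁ => (htgt (Sum.inl f)).2 rfl
  choose s₂ hs₂ using fun f : E₂ => hinr _ (fun h => by simpa using (hsrc (Sum.inr f)).1 h)
  choose t₂ ht₂ using fun f : E₂ => hinr _ (fun h => by simpa using (htgt (Sum.inr f)).1 h)
  choose g₁ hg₁ using hx.left
  choose g₂ hg₂ using fun j => hinr _ (hx.right j)
  obtain ⟨u, v, o, hu, hv⟩ : ∃ (u : V₁) (v : V₂) (o : Bool),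
      (x.src (Sum.inr ()) = if o then Sum.inl u else Sum.inr v) ∧
      (x.tgt (Sum.inr ()) = if o then Sum.inr v else Sum.inl u) := by
    rcases hx.ends with ⟨⟨u, hu⟩, hv, -⟩ | ⟨⟨u, hu⟩, hv, -⟩
    · obtain ⟨v, hv⟩ := hinr _ hv
      exact ⟨u, v, true, by simp [hu], by simp [hv]⟩
    · obtain ⟨v, hv⟩ := hinr _ hv
      exact ⟨u, v, false, by simp [hv], by simp [hu]⟩
  refine ⟨⟨s₁, t₁, Fin.snoc g₁ u, fun v => x.sgn (Sum.inl v), fun v => x.ord (Sum.inl v)⟩,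
    ⟨s₂, t₂, Fin.snoc g₂ v, fun v => x.sgn (Sum.inr v), fun v => x.ord (Sum.inr v)⟩, o, ?_⟩
  refine GenDiagram.ext ?_ ?_ ?_ ?_ ?_
  · funext f
    rcases f with (f | f) | f
    · simp [glue, hs₁]
    · simp [glue, hs₂]
    · simp [glue, hu]
  · funext f
    rcases f with (f | f) | f
    · simp [glue, ht₁]
    · simp [glue, ht₂]
    · simp [glue, hv]
  · funext i
    refine Fin.addCases (fun i => ?_) (fun i => ?_) i
    · simp [glue, hg₁]
    · simp [glue, hg₂]
  · funext v; cases v <;> rfl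
  · funext v; cases v <;> rfl

end GenDiagram

end GGreen

/-! ### The mass-shell measure and the integral of a glued diagram -/

namespace GGreen

namespace Theory

open GenDiagram

variable {n M k l : ℕ} {V E V' E' V₁ V₂ E₁ E₂ : Type}
variable {Ω K : Type*} [AddCommGroup Ω] [AddCommGroup K] [MeasureSpace Ω] [MeasureSpace K]

theorem neg_mem_shell (T : Theory Ω K) {q : Ω × K} (hq : q ∈ T.shell) : -q ∈ T.shell := by
  rcases hq with h | h
  · exact Or.inr (by simpa using h)
  · exact Or.inl (by simpa using h)

theorem measurable_shell_pos (T : Theory Ω K) : Measurable fun k => (T.disp k, k) :=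
  T.measurable_disp.prodMk measurable_id

section Measures

variable [MeasurableNeg Ω] [MeasurableNeg K]

instance : MeasurableNeg (Ω × K) :=
  ⟨(measurable_neg.comp measurable_fst).prodMk (measurable_neg.comp measurable_snd)⟩

theorem measurable_shell_neg (T : Theory Ω K) : Measurable fun k => (-T.disp k, -k) :=
  (measurable_neg.comp T.measurable_disp).prodMk measurable_neg

/-- Each of the two sheets projects to the measure of `K`, the second one after a change of sign,
and σ-finiteness can be pulled back along a measurable map. -/
instance [SigmaFinite (volume : Measure K)] (T : Theory Ω K) : SigmaFinite T.shellMeasure := by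
  have h1 : SigmaFinite (Measure.map (fun k => (T.disp k, k)) volume) := by
    refine SigmaFinite.of_map _ (f := Prod.snd) measurable_snd.aemeasurable ?_
    rw [Measure.map_map measurable_snd T.measurable_shell_pos]
    change SigmaFinite (Measure.map id volume)
    rw [Measure.map_id]
    infer_instance
  have h2 : SigmaFinite (Measure.map (fun k => (-T.disp k, -k)) volume) := by
    refine SigmaFinite.of_map _ (f := Neg.neg ∘ Prod.snd) (measurable_neg.comp measurable_snd).aemeasurable ?_
    rw [Measure.map_map (measurable_neg.comp measurable_snd) T.measurable_shell_neg]
    have : (Neg.neg ∘ Prod.snd) ∘ (fun k => (-T.disp k, -k)) = id := by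
      funext k; simp
    rw [this, Measure.map_id]
    infer_instance
  unfold shellMeasure
  infer_instance

instance [SigmaFinite (volume : Measure Ω)] [SigmaFinite (volume : Measure K)] (T : Theory Ω K)
    (a b : ℤˣ) : SigmaFinite (T.propMeasure a b) := by
  unfold propMeasure
  split_ifs
  · rw [Measure.volume_eq_prod]; infer_instance
  · infer_instance

/-- Negation exchanges the two sheets. -/
theorem measurePreserving_neg_shellMeasure (T : Theory Ω K) :
    MeasurePreserving (fun q : Ω × K => -q) T.shellMeasure T.shellMeasure := by
  refine ⟨measurable_neg, ?_⟩
  unfold shellMeasure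
  rw [Measure.map_add _ _ measurable_neg, Measure.map_map measurable_neg T.measurable_shell_pos,
    Measure.map_map measurable_neg T.measurable_shell_neg, add_comm]
  congr 2
  funext k
  simp

theorem measurableSet_shell [MeasurableEq Ω] (T : Theory Ω K) : MeasurableSet T.shell := by
  have h1 : MeasurableSet {q : Ω × K | q.1 = T.disp q.2} :=
    measurableSet_eq_fun measurable_fst (T.measurable_disp.comp measurable_snd)
  have h2 : MeasurableSet {q : Ω × K | -q.1 = T.disp (-q.2)} :=
    measurableSet_eq_fun (measurable_neg.comp measurable_fst) (T.measurable_disp.comp (measurable_neg.comp measurable_snd))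
  exact h1.union h2

theorem ae_mem_shell [MeasurableEq Ω] (T : Theory Ω K) :
    ∀ᵐ q ∂(T.propMeasure 1 (-1)), q ∈ T.shell := by
  have h : T.propMeasure 1 (-1) = T.shellMeasure := if_neg (by decide)
  rw [h, shellMeasure, ae_add_measure_iff]
  exact ⟨(ae_map_iff T.measurable_shell_pos.aemeasurable T.measurableSet_shell).2
      (Filter.Eventually.of_forall fun k => Or.inl rfl),
    (ae_map_iff T.measurable_shell_neg.aemeasurable T.measurableSet_shell).2
      (Filter.Eventually.of_forall fun k => Or.inr (by simp))⟩

end Measures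

/-- The integrand of a diagram. -/
noncomputable def genIntegrand [Fintype V] [Fintype E] (T : Theory Ω K) (x : GenDiagram n M V E)
    (p : Fin n → Ω × K) (q : E → Ω × K) : ℂ :=
  (∏ e, T.prop (x.sgn (x.src e)) (x.sgn (x.tgt e)) (q e)) *
    ∏ v, (T.delta (x.incoming p q v).sum * T.vertex (x.sgn v) (x.ord v) (x.incoming p q v))

/-- The product of the measures belonging to the propagators of the edges. -/
noncomputable def genMeasure [Fintype E] (T : Theory Ω K) (x : GenDiagram n M V E) :
    Measure (E → Ω × K) :=
  Measure.pi fun e => T.propMeasure (x.sgn (x.src e)) (x.sgn (x.tgt e))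

/-- The integral belonging to a diagram, without symmetry factor. -/
noncomputable def genIntegral [Fintype V] [Fintype E] (T : Theory Ω K) (x : GenDiagram n M V E)
    (p : Fin n → Ω × K) : ℂ :=
  ∫ q, T.genIntegrand x p q ∂(T.genMeasure x)

theorem genIntegrand_relabel [Fintype V] [Fintype E] [Fintype V'] [Fintype E'] (T : Theory Ω K)
    (σ : V ≃ V') (τ : E ≃ E') (x : GenDiagram n M V E) (p : Fin n → Ω × K) (q : E' → Ω × K) :
    T.genIntegrand (x.relabel σ τ) p q = T.genIntegrand x p fun f => q (τ f) := by
  unfold genIntegrand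
  congr 1
  · exact Fintype.prod_equiv τ.symm _ _ fun f => by simp [relabel]
  · refine Fintype.prod_equiv σ.symm _ _ fun v => ?_
    obtain ⟨v, rfl⟩ := σ.surjective v
    rw [incoming_relabel]
    simp [relabel]

/-- Joining the momenta of two families of edges and of one more edge. -/
def joinMomenta (E₁ E₂ P : Type*) [MeasurableSpace P] :
    P × (E₁ → P) × (E₂ → P) ≃ᵐ ((E₁ ⊕ E₂) ⊕ Unit → P) where
  toFun a := Sum.elim (Sum.elim a.2.1 a.2.2) fun _ => a.1
  invFun q := (q (Sum.inr ()), fun f => q (Sum.inl (Sum.inl f)), fun f => q (Sum.inl (Sum.inr f)))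
  left_inv a := rfl
  right_inv q := by
    funext f
    rcases f with (f | f) | f <;> rfl
  measurable_toFun := by
    refine measurable_pi_iff.2 ?_
    rintro ((f | f) | f)
    · exact (measurable_pi_apply f).comp (measurable_fst.comp measurable_snd)
    · exact (measurable_pi_apply f).comp (measurable_snd.comp measurable_snd)
    · exact measurable_fst
  measurable_invFun := by
    refine (measurable_pi_apply _).prodMk (Measurable.prodMk ?_ ?_)
    · exact measurable_pi_iff.2 fun f => measurable_pi_apply _
    · exact measurable_pi_iff.2 fun f => measurable_pi_apply _

theorem measurePreserving_joinMomenta [Fintype E₁] [Fintype E₂] {P : Type*} [MeasurableSpace P]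
    (μ : (E₁ ⊕ E₂) ⊕ Unit → Measure P) [∀ f, SigmaFinite (μ f)] :
    MeasurePreserving (joinMomenta E₁ E₂ P)
      ((μ (Sum.inr ())).prod ((Measure.pi fun f => μ (Sum.inl (Sum.inl f))).prod
        (Measure.pi fun f => μ (Sum.inl (Sum.inr f))))) (Measure.pi μ) := by
  refine ⟨MeasurableEquiv.measurable _, (Measure.pi_eq fun s _ => ?_).symm⟩
  rw [MeasurableEquiv.map_apply]
  have : joinMomenta E₁ E₂ P ⁻¹' Set.univ.pi s = s (Sum.inr ()) ×ˢ
      ((Set.univ.pi fun f => s (Sum.inl (Sum.inl f))) ×ˢ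
        (Set.univ.pi fun f => s (Sum.inl (Sum.inr f)))) := by
    ext a
    simp [joinMomenta, Set.mem_pi]
    tauto
  rw [this, Measure.prod_prod, Measure.prod_prod, Measure.pi_pi, Measure.pi_pi]
  simp [Fintype.prod_sum_type, mul_comm]

/-- By `prop_symm`, reversing the joining edge amounts to negating its momentum. -/
theorem genIntegrand_glue [Fintype V₁] [Fintype E₁] [Fintype V₂] [Fintype E₂] (T : Theory Ω K)
    (y : GenDiagram (k + 1) M V₁ E₁) (z : GenDiagram (l + 1) M V₂ E₂) (o : Bool)
    (hy : y.sgn (y.leg (Fin.last k)) = 1) (hz : z.sgn (z.leg (Fin.last l)) = -1)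
    (p : Fin k → Ω × K) (p' : Fin l → Ω × K) (a : (Ω × K) × (E₁ → Ω × K) × (E₂ → Ω × K)) :
    T.genIntegrand (glue y z o) (Fin.append p p') (joinMomenta E₁ E₂ (Ω × K) a) =
      T.prop 1 (-1) (if o then a.1 else -a.1) *
        (T.genIntegrand y (Fin.snoc p (if o then a.1 else -a.1) : Fin (k + 1) → Ω × K) a.2.1 *
        T.genIntegrand z (Fin.snoc p' (-if o then a.1 else -a.1) : Fin (l + 1) → Ω × K) a.2.2) := by
  have h : (-if o then a.1 else -a.1) = if o then -a.1 else a.1 := by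
    cases o <;> simp
  have h' : T.prop ((glue y z o).sgn ((glue y z o).src (Sum.inr ())))
      ((glue y z o).sgn ((glue y z o).tgt (Sum.inr ()))) a.1 =
        T.prop 1 (-1) (if o then a.1 else -a.1) := by
    cases o
    · simp only [glue, Sum.elim_inr, Sum.elim_inl, Bool.false_eq_true, if_false, hy, hz]
      exact T.prop_symm _ _ _
    · simp only [glue, Sum.elim_inr, Sum.elim_inl, if_true, hy, hz]
  have hj : joinMomenta E₁ E₂ (Ω × K) a = Sum.elim (Sum.elim a.2.1 a.2.2) fun _ => a.1 := rfl
  rw [hj]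
  unfold genIntegrand
  simp only [Fintype.prod_sum_type, incoming_glue_inl, incoming_glue_inr, Finset.univ_unique,
    Finset.prod_singleton, h]
  rw [← h']
  change _ * _ * T.prop _ _ a.1 * _ = _
  simp only [glue, Sum.elim_inl, Sum.elim_inr, Sum.map_inl, Sum.map_inr]
  ring

theorem genIntegrand_relabel_comp [Fintype V] [Fintype E] [Fintype V'] [Fintype E']
    (T : Theory Ω K) (σ : V ≃ V') (τ : E ≃ E') (x : GenDiagram n M V E) (p : Fin n → Ω × K)
    (q : E → Ω × K) :
    T.genIntegrand (x.relabel σ τ) p (MeasurableEquiv.piCongrLeft (fun _ : E' => Ω × K) τ q) =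
      T.genIntegrand x p q := by
  rw [genIntegrand_relabel]
  congr 1
  funext f
  exact MeasurableEquiv.piCongrLeft_apply_apply (β := fun _ : E' => Ω × K) τ q f

section Integrals

variable [MeasurableNeg Ω] [MeasurableNeg K]
  [SigmaFinite (volume : Measure Ω)] [SigmaFinite (volume : Measure K)]

theorem measurePreserving_relabel [Fintype E] [Fintype E'] (T : Theory Ω K)
    (σ : V ≃ V') (τ : E ≃ E') (x : GenDiagram n M V E) :
    MeasurePreserving (MeasurableEquiv.piCongrLeft (fun _ : E' => Ω × K) τ) (T.genMeasure x)
      (T.genMeasure (x.relabel σ τ)) := by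
  have := measurePreserving_piCongrLeft (α := fun _ : E' => Ω × K)
    (fun e => T.propMeasure ((x.relabel σ τ).sgn ((x.relabel σ τ).src e))
      ((x.relabel σ τ).sgn ((x.relabel σ τ).tgt e))) τ
  simpa [relabel, genMeasure] using this

theorem genIntegral_relabel [Fintype V] [Fintype E] [Fintype V'] [Fintype E'] (T : Theory Ω K)
    (σ : V ≃ V') (τ : E ≃ E') (x : GenDiagram n M V E) (p : Fin n → Ω × K) :
    T.genIntegral (x.relabel σ τ) p = T.genIntegral x p := by
  unfold genIntegral
  rw [← (T.measurePreserving_relabel σ τ x).integral_comp (MeasurableEquiv.measurableEmbedding _)]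
  simp only [genIntegrand_relabel_comp]

theorem integrable_relabel [Fintype V] [Fintype E] [Fintype V'] [Fintype E'] (T : Theory Ω K)
    (σ : V ≃ V') (τ : E ≃ E') (x : GenDiagram n M V E) (p : Fin n → Ω × K)
    (h : Integrable (T.genIntegrand (x.relabel σ τ) p) (T.genMeasure (x.relabel σ τ))) :
    Integrable (T.genIntegrand x p) (T.genMeasure x) := by
  rw [← (T.measurePreserving_relabel σ τ x).integrable_comp_emb
    (MeasurableEquiv.measurableEmbedding _)] at h
  exact h.congr (Filter.Eventually.of_forall fun q => T.genIntegrand_relabel_comp σ τ x p q)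

/-- Fubini with the momentum of the joining edge outermost. The integrability of `F` is that of a
partial integral, so only the glued diagram has to converge. For `o = false` the momentum is
negated, which preserves the shell measure. -/
theorem integral_glue [Fintype V₁] [Fintype E₁] [Fintype V₂] [Fintype E₂] (T : Theory Ω K)
    (y : GenDiagram (k + 1) M V₁ E₁) (z : GenDiagram (l + 1) M V₂ E₂) (o : Bool)
    (hy : y.sgn (y.leg (Fin.last k)) = 1) (hz : z.sgn (z.leg (Fin.last l)) = -1)
    (p : Fin k → Ω × K) (p' : Fin l → Ω × K)
    (h : Integrable (T.genIntegrand (glue y z o) (Fin.append p p')) (T.genMeasure (glue y z o))) :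
    let F : Ω × K → ℂ := fun q => T.prop 1 (-1) q *
      (T.genIntegral y (Fin.snoc p q : Fin (k + 1) → Ω × K) *
        T.genIntegral z (Fin.snoc p' (-q) : Fin (l + 1) → Ω × K))
    Integrable F (T.propMeasure 1 (-1)) ∧
      T.genIntegral (glue y z o) (Fin.append p p') = ∫ q, F q ∂(T.propMeasure 1 (-1)) := by
  intro F
  have hs : T.propMeasure 1 (-1) = T.shellMeasure := if_neg (by decide)
  have hs' : T.propMeasure (-1) 1 = T.shellMeasure := if_neg (by decide)
  have hmp := measurePreserving_joinMomenta (E₁ := E₁) (E₂ := E₂)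
    (fun e => T.propMeasure ((glue y z o).sgn ((glue y z o).src e))
      ((glue y z o).sgn ((glue y z o).tgt e)))
  have he : T.propMeasure ((glue y z o).sgn ((glue y z o).src (Sum.inr ())))
      ((glue y z o).sgn ((glue y z o).tgt (Sum.inr ()))) = T.shellMeasure := by
    cases o
    · simpa [glue, hy, hz] using hs'
    · simpa [glue, hy, hz] using hs
  rw [he] at hmp
  change MeasurePreserving _ (T.shellMeasure.prod ((T.genMeasure y).prod (T.genMeasure z)))
    (T.genMeasure (glue y z o)) at hmp
  have hint := (hmp.integrable_comp_emb (MeasurableEquiv.measurableEmbedding _)).2 h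
  have hF : ∀ q, ∫ a, T.genIntegrand (glue y z o) (Fin.append p p')
      (joinMomenta E₁ E₂ (Ω × K) (q, a)) ∂((T.genMeasure y).prod (T.genMeasure z)) =
        F (if o then q else -q) := fun q => by
    simp only [genIntegrand_glue T y z o hy hz, integral_const_mul]
    have : SigmaFinite (T.genMeasure y) := by unfold genMeasure; infer_instance
    have : SigmaFinite (T.genMeasure z) := by unfold genMeasure; infer_instance
    -- No integrability is needed for a product of functions of separate variables, so this holds
    -- for every `q`.
    rw [integral_prod_mul]
    rfl
  have : SFinite ((T.genMeasure y).prod (T.genMeasure z)) := by unfold genMeasure; infer_instance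
  have hI : Integrable (fun q => F (if o then q else -q)) T.shellMeasure :=
    hint.integral_prod_left.congr (Filter.Eventually.of_forall hF)
  have hE : T.genIntegral (glue y z o) (Fin.append p p') =
      ∫ q, F (if o then q else -q) ∂T.shellMeasure := by
    unfold genIntegral
    rw [← hmp.integral_comp (MeasurableEquiv.measurableEmbedding _)]
    exact (integral_prod _ hint).trans (integral_congr_ae (Filter.Eventually.of_forall hF))
  rw [hs]
  cases o
  · have hneg := T.measurePreserving_neg_shellMeasure
    have hemb := (MeasurableEquiv.neg (Ω × K)).measurableEmbedding
    refine ⟨(hneg.integrable_comp_emb hemb).1 (by simpa [Function.comp_def] using hI), ?_⟩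
    rw [hE, ← hneg.integral_comp hemb]
    simp
  · exact ⟨by simpa using hI, by simpa using hE⟩

end Integrals

end Theory

end GGreen

/-! ### Symmetry factors and label bijections -/

namespace GGreen

theorem sum_triangle_eq_sum_box {n : ℕ} (g : ℕ → ℕ → ℂ) (hg : ∀ i j, n < i + j → g i j = 0) :
    ∑ s ∈ Finset.range (n + 1), ∑ i ∈ Finset.range (s + 1), g i (s - i) =
      ∑ i ∈ Finset.range (n + 1), ∑ j ∈ Finset.range (n + 1), g i j := by
  rw [Finset.sum_range_diag_flip]
  refine Finset.sum_congr rfl fun i _ => Finset.sum_subset (fun j hj => ?_) fun j _ hj => hg i j ?_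
  · simp only [Finset.mem_range] at hj ⊢; omega
  · simp only [Finset.mem_range] at hj; omega

/-- The weight of a labelled diagram with `v` vertices and `m` edges. -/
noncomputable def labelWeight (v m : ℕ) : ℂ :=
  ((v.factorial * (2 ^ m * m.factorial) : ℕ) : ℂ)⁻¹

/-- The binomial coefficients choose the vertices and edges of the first side, and `m₂ + 1` is the
number of candidates for the cut edge. Of the powers of 2 one factor is left over, belonging to the
orientation of the cut edge. -/
theorem labelWeight_mul_choose (v₁ v₂ m₁ m₂ : ℕ) :
    labelWeight (v₁ + v₂) (m₁ + (m₂ + 1)) * (v₁ + v₂).choose v₁ *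
      ((m₁ + (m₂ + 1)).choose m₁ * ((m₂ + 1 : ℕ) : ℂ)) =
        labelWeight v₁ m₁ * labelWeight v₂ m₂ * 2⁻¹ := by
  have h1 : (((v₁ + v₂).choose v₁ : ℂ)) * v₁.factorial * v₂.factorial = (v₁ + v₂).factorial := by
    rw [Nat.choose_symm_add]
    exact_mod_cast Nat.add_choose_mul_factorial_mul_factorial v₁ v₂
  have h2 : (((m₁ + (m₂ + 1)).choose m₁ : ℂ)) * m₁.factorial * ((m₂ + 1 : ℕ) * m₂.factorial) =
      (m₁ + (m₂ + 1)).factorial := by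
    rw [← Nat.cast_mul (m₂ + 1), ← Nat.factorial_succ]
    rw [Nat.choose_symm_add]
    exact_mod_cast Nat.add_choose_mul_factorial_mul_factorial m₁ (m₂ + 1)
  unfold labelWeight
  simp only [Nat.cast_mul, Nat.cast_pow, Nat.cast_ofNat]
  rw [← h1, ← h2]
  have f1 : (v₁.factorial : ℂ) ≠ 0 := by exact_mod_cast v₁.factorial_ne_zero
  have f2 : (v₂.factorial : ℂ) ≠ 0 := by exact_mod_cast v₂.factorial_ne_zero
  have f3 : (m₁.factorial : ℂ) ≠ 0 := by exact_mod_cast m₁.factorial_ne_zero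
  have f4 : (m₂.factorial : ℂ) ≠ 0 := by exact_mod_cast m₂.factorial_ne_zero
  have f5 : ((v₁ + v₂).choose v₁ : ℂ) ≠ 0 := by
    exact_mod_cast (Nat.choose_pos (Nat.le_add_right v₁ v₂)).ne'
  have f6 : ((m₁ + (m₂ + 1)).choose m₁ : ℂ) ≠ 0 := by
    exact_mod_cast (Nat.choose_pos (Nat.le_add_right m₁ (m₂ + 1))).ne'
  have f7 : ((m₂ + 1 : ℕ) : ℂ) ≠ 0 := by exact_mod_cast m₂.succ_ne_zero
  field_simp
  ring

theorem sum_labelWeight_split (N B : ℕ) (Ψ : ℕ → ℕ → ℕ → ℕ → ℂ)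
    (hv : ∀ v₁ v₂ m₁ m₂, N < v₁ + v₂ → Ψ v₁ v₂ m₁ m₂ = 0)
    (hm : ∀ v₁ v₂ m₁ m₂, B < m₁ + m₂ + 1 → Ψ v₁ v₂ m₁ m₂ = 0) :
    ∑ v ∈ Finset.range (N + 1), ∑ m ∈ Finset.range (B + 1), labelWeight v m *
      ∑ v₁ ∈ Finset.range (v + 1), v.choose v₁ • ∑ m₁ ∈ Finset.range (m + 1), m.choose m₁ •
        (m - m₁) • Ψ v₁ (v - v₁) m₁ (m - m₁ - 1) =
    ∑ v₁ ∈ Finset.range (N + 1), ∑ v₂ ∈ Finset.range (N + 1), ∑ m₁ ∈ Finset.range (B + 1),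
      ∑ m₂ ∈ Finset.range (B + 1),
        labelWeight v₁ m₁ * labelWeight v₂ m₂ * 2⁻¹ * Ψ v₁ v₂ m₁ m₂ := by
  -- Here `j` counts the edges outside the first side including the cut edge, so `j = m₂ + 1`. The
  -- factor `j` kills the term `j = 0`, where `j - 1` is truncated.
  let G : ℕ → ℕ → ℕ → ℕ → ℂ := fun v₁ v₂ m₁ j =>
    labelWeight (v₁ + v₂) (m₁ + j) * (v₁ + v₂).choose v₁ *
      ((m₁ + j).choose m₁ * (j : ℂ)) * Ψ v₁ v₂ m₁ (j - 1)
  have h1 : ∀ v ∈ Finset.range (N + 1), ∑ m ∈ Finset.range (B + 1), labelWeight v m *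
      ∑ v₁ ∈ Finset.range (v + 1), v.choose v₁ • ∑ m₁ ∈ Finset.range (m + 1), m.choose m₁ •
        (m - m₁) • Ψ v₁ (v - v₁) m₁ (m - m₁ - 1) =
      ∑ v₁ ∈ Finset.range (v + 1), ∑ m₁ ∈ Finset.range (B + 1), ∑ j ∈ Finset.range (B + 1),
        G v₁ (v - v₁) m₁ j := by
    intro v _
    simp only [Finset.mul_sum, Finset.smul_sum]
    rw [Finset.sum_comm]
    refine Finset.sum_congr rfl fun v₁ hv₁ => ?_
    rw [← sum_triangle_eq_sum_box]
    · refine Finset.sum_congr rfl fun m _ => Finset.sum_congr rfl fun m₁ hm₁ => ?_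
      have e1 : v₁ + (v - v₁) = v := by simp only [Finset.mem_range] at hv₁; omega
      have e2 : m₁ + (m - m₁) = m := by simp only [Finset.mem_range] at hm₁; omega
      simp only [G, e1, e2, nsmul_eq_mul]
      ring
    · intro m₁ j hj
      rcases j with _ | j
      · simp [G]
      · simp only [G]
        rw [hm _ _ _ _ (by omega), mul_zero]
  rw [Finset.sum_congr rfl h1, sum_triangle_eq_sum_box
    fun v₁ v₂ => ∑ m₁ ∈ Finset.range (B + 1), ∑ j ∈ Finset.range (B + 1), G v₁ v₂ m₁ j]
  · refine Finset.sum_congr rfl fun v₁ _ => Finset.sum_congr rfl fun v₂ _ =>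
      Finset.sum_congr rfl fun m₁ _ => ?_
    rw [Finset.sum_range_succ', Finset.sum_range_succ _ B, hm v₁ v₂ m₁ B (by omega)]
    congr 1
    · refine Finset.sum_congr rfl fun m₂ _ => ?_
      rw [← labelWeight_mul_choose]
      rfl
    · simp [G]
  · intro v₁ v₂ h
    exact Finset.sum_eq_zero fun m₁ _ => Finset.sum_eq_zero fun j _ => by
      simp only [G]; rw [hv _ _ _ _ h, mul_zero]

theorem exists_sum_equiv {V : Type} [Fintype V] (A : Finset V) :
    ∃ σ : Fin A.card ⊕ Fin (Fintype.card V - A.card) ≃ V, σ ⁻¹' A = Set.range Sum.inl := by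
  classical
  have h : Fintype.card {v // v ∉ A} = Fintype.card V - A.card := by
    rw [Fintype.card_subtype_compl, Fintype.card_coe]
  refine ⟨(Equiv.sumCongr A.equivFin.symm (Fintype.equivFinOfCardEq h).symm).trans
    (Equiv.sumCompl (· ∈ A)), ?_⟩
  ext (v | v)
  · simp
  · simpa using ((Fintype.equivFinOfCardEq h).symm v).2

theorem exists_sum_unit_equiv {E : Type} [Fintype E] (B : Finset E) (e : E) (he : e ∉ B) :
    ∃ τ : (Fin B.card ⊕ Fin (Fintype.card E - B.card - 1)) ⊕ Unit ≃ E,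
      τ (Sum.inr ()) = e ∧ ∀ f, τ (Sum.inl f) ∈ B ↔ f.isLeft := by
  classical
  have h : Fintype.card {f // f ∉ insert e B} = Fintype.card E - B.card - 1 := by
    rw [Fintype.card_subtype_compl, Fintype.card_coe, Finset.card_insert_of_notMem he]
    omega
  let g := (Fintype.equivFinOfCardEq h).symm
  let t : (Fin B.card ⊕ Fin (Fintype.card E - B.card - 1)) ⊕ Unit → E :=
    Sum.elim (Sum.elim (fun i => B.equivFin.symm i) fun i => g i) fun _ => e
  have hg : ∀ i, (g i : E) ≠ e ∧ (g i : E) ∉ B := fun i => by simpa using (g i).2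
  have hB : ∀ i, (B.equivFin.symm i : E) ∈ B := fun i => (B.equivFin.symm i).2
  have hinj : Function.Injective t := by
    rintro ((a | a) | a) ((b | b) | b) hab
    · simpa [t] using hab
    · exact ((hg b).2 ((show (B.equivFin.symm a : E) = g b from hab) ▸ hB a)).elim
    · exact (he ((show (B.equivFin.symm a : E) = e from hab) ▸ hB a)).elim
    · exact ((hg a).2 ((show (B.equivFin.symm b : E) = g a from hab.symm) ▸ hB b)).elim
    · simpa [t, Subtype.val_inj] using hab
    · exact absurd hab (hg a).1
    · exact (he ((show (B.equivFin.symm b : E) = e from hab.symm) ▸ hB b)).elim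
    · exact absurd hab.symm (hg b).1
    · rfl
  have hsurj : Function.Surjective t := by
    intro f
    by_cases hf : f ∈ B
    · exact ⟨Sum.inl (Sum.inl (B.equivFin ⟨f, hf⟩)), by simp [t]⟩
    by_cases hfe : f = e
    · exact ⟨Sum.inr (), hfe.symm⟩
    · exact ⟨Sum.inl (Sum.inr (g.symm ⟨f, by simp [hf, hfe]⟩)), by simp [t]⟩
  refine ⟨Equiv.ofBijective t ⟨hinj, hsurj⟩, rfl, ?_⟩
  rintro (f | f)
  · exact ⟨fun _ => rfl, fun _ => hB f⟩
  · exact ⟨fun h => ((hg f).2 h).elim, fun h => by simp at h⟩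

end GGreen

/-! ### Counting labelled diagrams with a marked separating edge -/

namespace GGreen

namespace GenDiagram

variable {n M k l : ℕ} {V E : Type}

/-- A diagram of order `N` with a separating edge `e` that cuts off `A`; if `r` holds, it has to be
the first separating edge. -/
def IsMarked [Fintype V] [Fintype E] (x : GenDiagram (k + l) M V E) (d : ℕ → ℕ) (N : ℕ)
    (ε : Fin (k + l) → ℤˣ) (r : Prop) (e : E) (A : Set V) : Prop :=
  x.IsGood d N ε ∧ x.IsCut e A ∧ x.IsFirst r A

theorem IsGood.card_le [Fintype V] [Fintype E] {x : GenDiagram n M V E} {d : ℕ → ℕ} {N : ℕ}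
    {ε : Fin n → ℤˣ} (hx : x.IsGood d N ε) : Fintype.card V ≤ N := by
  have h : ∑ _v : V, 1 ≤ ∑ v, (x.ord v : ℕ) := Finset.sum_le_sum fun v _ => hx.one_le_ord v
  simpa [hx.sum_ord] using h

theorem sum_card_singletonIf {ι P : Type*} [Fintype ι] [Fintype V] (g : ι → V) (a : ι → P) :
    ∑ v, (∑ i, singletonIf (g i = v) (a i)).card = Fintype.card ι := by
  classical
  simp only [Multiset.card_sum]
  rw [Finset.sum_comm]
  simp [singletonIf, apply_ite Multiset.card]

theorem sum_degree [Fintype V] [Fintype E] (x : GenDiagram n M V E) :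
    ∑ v, x.degree v = n + Fintype.card E + Fintype.card E := by
  unfold degree incoming
  simp only [Multiset.card_add, Finset.sum_add_distrib]
  simp only [sum_card_singletonIf, Fintype.card_fin]

theorem IsGood.card_edges_le [Fintype V] [Fintype E] {x : GenDiagram n M V E} {d : ℕ → ℕ}
    {a N : ℕ} {ε : Fin n → ℤˣ} (hx : x.IsGood d a ε) (ha : a ≤ N) :
    Fintype.card E ≤ N * ∑ j ∈ Finset.range (N + 1), d j := by
  have h1 : ∀ v, x.degree v ≤ ∑ j ∈ Finset.range (N + 1), d j := fun v => by
    refine (hx.degree_le v).trans (Finset.single_le_sum (f := d) (fun i _ => Nat.zero_le _) ?_)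
    have : (x.ord v : ℕ) ≤ a :=
      hx.sum_ord ▸ Finset.single_le_sum (f := fun v => (x.ord v : ℕ)) (fun i _ => Nat.zero_le _)
        (Finset.mem_univ v)
    simp only [Finset.mem_range]
    omega
  calc Fintype.card E ≤ ∑ v, x.degree v := by rw [sum_degree]; omega
    _ ≤ ∑ _v : V, ∑ j ∈ Finset.range (N + 1), d j := Finset.sum_le_sum fun v _ => h1 v
    _ = Fintype.card V * ∑ j ∈ Finset.range (N + 1), d j := by simp
    _ ≤ _ := Nat.mul_le_mul_right _ (hx.card_le.trans ha)

end GenDiagram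

namespace Theory

open GenDiagram

variable {n M k l : ℕ} {V E : Type}
variable {Ω K : Type*} [AddCommGroup Ω] [AddCommGroup K] [MeasureSpace Ω] [MeasureSpace K]

open Classical in
/-- The sum of all diagrams with given numbers of vertices and edges on the two sides of a
marked separating edge, the labels of the two sides being kept apart. -/
noncomputable def glueSum (T : Theory Ω K) (M N : ℕ) (r : Prop) (p : Fin k → Ω × K)
    (ε : Fin k → ℤˣ) (p' : Fin l → Ω × K) (ε' : Fin l → ℤˣ) (v₁ v₂ m₁ m₂ : ℕ) : ℂ :=
  ∑ w : GenDiagram (k + 1) M (Fin v₁) (Fin m₁) × GenDiagram (l + 1) M (Fin v₂) (Fin m₂) × Bool,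
    if (glue w.1 w.2.1 w.2.2).IsMarked T.maxDeg N (Fin.append ε ε') r (Sum.inr ())
      (Set.range Sum.inl) then T.genIntegral (glue w.1 w.2.1 w.2.2) (Fin.append p p') else 0

theorem glueSum_eq_zero_of_lt_vertices (T : Theory Ω K) (N : ℕ) (r : Prop)
    (p : Fin k → Ω × K) (ε : Fin k → ℤˣ) (p' : Fin l → Ω × K) (ε' : Fin l → ℤˣ)
    (v₁ v₂ m₁ m₂ : ℕ) (h : N < v₁ + v₂) : T.glueSum M N r p ε p' ε' v₁ v₂ m₁ m₂ = 0 := by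
  refine Finset.sum_eq_zero fun w _ => if_neg fun hw => ?_
  have := hw.1.card_le
  simp only [Fintype.card_sum, Fintype.card_fin] at this
  omega

theorem glueSum_eq_zero_of_lt_edges (T : Theory Ω K) (N : ℕ) (r : Prop)
    (p : Fin k → Ω × K) (ε : Fin k → ℤˣ) (p' : Fin l → Ω × K) (ε' : Fin l → ℤˣ)
    (v₁ v₂ m₁ m₂ : ℕ) (h : N * ∑ j ∈ Finset.range (N + 1), T.maxDeg j < m₁ + m₂ + 1) :
    T.glueSum M N r p ε p' ε' v₁ v₂ m₁ m₂ = 0 := by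
  refine Finset.sum_eq_zero fun w _ => if_neg fun hw => ?_
  have := hw.1.card_edges_le le_rfl
  simp only [Fintype.card_sum, Fintype.card_fin, Fintype.card_unit] at this
  omega

variable [MeasurableNeg Ω] [MeasurableNeg K]
  [SigmaFinite (volume : Measure Ω)] [SigmaFinite (volume : Measure K)]

open Classical in
-- With the side `A`, its edges `B` and the cut edge `e` prescribed, a bijection of labels carries
-- the glued diagrams exactly onto the marked ones, and it does not change the integral.
theorem sum_isMarked_fixed [Fintype V] [Fintype E] (T : Theory Ω K) (N : ℕ) (r : Prop)
    (p : Fin k → Ω × K) (ε : Fin k → ℤˣ) (p' : Fin l → Ω × K) (ε' : Fin l → ℤˣ)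
    (A : Finset V) (B : Finset E) (e : E) (he : e ∉ B) :
    (∑ x : GenDiagram (k + l) M V E,
      if x.IsMarked T.maxDeg N (Fin.append ε ε') r e A ∧ ∀ f, f ∈ B ↔ f ≠ e ∧ x.src f ∈ A then
        T.genIntegral x (Fin.append p p') else 0) =
      T.glueSum M N r p ε p' ε' A.card (Fintype.card V - A.card) B.card
        (Fintype.card E - B.card - 1) := by
  obtain ⟨σ, hσ⟩ := exists_sum_equiv A
  obtain ⟨τ, hτe, hτ⟩ := exists_sum_unit_equiv B e he
  unfold glueSum
  symm
  refine Fintype.sum_of_injective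
    (fun w => (glue w.1 w.2.1 w.2.2).relabel σ τ)
    ((relabelEquiv σ τ).injective.comp glue_injective) _ _ (fun x hx => if_neg fun h => ?_)
    fun w => ?_
  · obtain ⟨x, rfl⟩ := (relabelEquiv σ τ).surjective x
    change (x.relabel σ τ).IsMarked T.maxDeg N (Fin.append ε ε') r e A ∧ _ at h
    obtain ⟨⟨-, hcut, -⟩, hB⟩ := h
    rw [isCut_relabel, hσ, ← hτe, Equiv.symm_apply_apply] at hcut
    obtain ⟨y, z, o, rfl⟩ := exists_glue_eq x hcut fun f => by
      have := hB (τ (Sum.inl f))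
      rw [hτ] at this
      rw [← hσ, this, ← hτe]
      simp [relabelEquiv, relabel]
    exact hx ⟨(y, z, o), rfl⟩
  · obtain ⟨y, z, o⟩ := w
    refine if_congr ?_ (T.genIntegral_relabel σ τ _ _).symm rfl
    unfold IsMarked
    rw [isGood_relabel, isCut_relabel, isFirst_relabel, hσ, ← hτe, Equiv.symm_apply_apply]
    refine (and_iff_left fun f => ?_).symm
    obtain ⟨f, rfl⟩ := τ.surjective f
    have hA : ∀ v, σ v ∈ A ↔ v ∈ Set.range Sum.inl := fun v => by rw [← hσ]; rfl
    rcases f with (f | f) | f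
    · rw [hτ]; simp [relabel, hA, glue]
    · rw [hτ]; simp [relabel, hA, glue]
    · simp [hτe, he]

open Classical in
-- Sorting by `A` and by the set `B` of edges inside it yields the binomial coefficients; the
-- remaining factor counts the edges `e ∉ B`.
theorem sum_isMarked [Fintype V] [Fintype E] (T : Theory Ω K) (N : ℕ) (r : Prop)
    (p : Fin k → Ω × K) (ε : Fin k → ℤˣ) (p' : Fin l → Ω × K) (ε' : Fin l → ℤˣ) :
    (∑ x : GenDiagram (k + l) M V E, ∑ e : E, ∑ A : Finset V,
      if x.IsMarked T.maxDeg N (Fin.append ε ε') r e A then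
        T.genIntegral x (Fin.append p p') else 0) =
      ∑ v₁ ∈ Finset.range (Fintype.card V + 1), (Fintype.card V).choose v₁ •
        ∑ m₁ ∈ Finset.range (Fintype.card E + 1), (Fintype.card E).choose m₁ •
          (Fintype.card E - m₁) • T.glueSum M N r p ε p' ε' v₁ (Fintype.card V - v₁) m₁
            (Fintype.card E - m₁ - 1) := by
  have hpow : ∀ (W : Type) [Fintype W] (f : ℕ → ℂ), ∑ A : Finset W, f A.card =
      ∑ j ∈ Finset.range (Fintype.card W + 1), (Fintype.card W).choose j • f j := fun W _ f => by
    rw [← Finset.powerset_univ, Finset.sum_powerset_apply_card, Finset.card_univ]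
  rw [← hpow V (fun v₁ => ∑ m₁ ∈ Finset.range (Fintype.card E + 1), (Fintype.card E).choose m₁ •
          (Fintype.card E - m₁) • T.glueSum M N r p ε p' ε' v₁ (Fintype.card V - v₁) m₁
            (Fintype.card E - m₁ - 1))]
  -- Exactly one `B` fits given `x`, `e` and `A`, so a sum over `B` may be inserted.
  have hB : ∀ (x : GenDiagram (k + l) M V E) (e : E) (A : Finset V),
      (if x.IsMarked T.maxDeg N (Fin.append ε ε') r e A then
        T.genIntegral x (Fin.append p p') else 0) =
      ∑ B : Finset E, if e ∈ B then 0 else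
        if x.IsMarked T.maxDeg N (Fin.append ε ε') r e A ∧ ∀ f, f ∈ B ↔ f ≠ e ∧ x.src f ∈ A then
          T.genIntegral x (Fin.append p p') else 0 := by
    intro x e A
    rw [Finset.sum_eq_single (Finset.univ.filter fun f => f ≠ e ∧ x.src f ∈ A)]
    · simp
    · intro B _ hne
      split_ifs with h1 h2
      · rfl
      · exact absurd (by ext f; simpa using h2.2 f) hne
      · rfl
    · simp
  simp only [hB]
  have hswap : ∀ g : GenDiagram (k + l) M V E → E → Finset V → Finset E → ℂ,
      ∑ x, ∑ e, ∑ A, ∑ B, g x e A B = ∑ A, ∑ B, ∑ e, ∑ x, g x e A B := fun g => by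
    rw [Finset.sum_comm]
    calc ∑ e, ∑ x, ∑ A, ∑ B, g x e A B = ∑ e, ∑ A, ∑ B, ∑ x, g x e A B := by
          refine Finset.sum_congr rfl fun e _ => ?_
          rw [Finset.sum_comm]
          exact Finset.sum_congr rfl fun A _ => Finset.sum_comm
      _ = _ := by
          rw [Finset.sum_comm]
          exact Finset.sum_congr rfl fun A _ => Finset.sum_comm
  rw [hswap]
  refine Finset.sum_congr rfl fun A _ => ?_
  rw [← hpow E (fun m₁ => (Fintype.card E - m₁) • T.glueSum M N r p ε p' ε' A.card
    (Fintype.card V - A.card) m₁ (Fintype.card E - m₁ - 1))]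
  refine Finset.sum_congr rfl fun B _ => ?_
  rw [← Finset.card_compl, ← Finset.sum_const, ← Finset.sum_subset (Finset.subset_univ Bᶜ)]
  · refine Finset.sum_congr rfl fun e he => ?_
    have he' : e ∉ B := by simpa using he
    simp only [he', if_false]
    rw [T.sum_isMarked_fixed N r p ε p' ε' A B e he']
    rw [Finset.card_compl]
  · intro e _ he
    have he' : e ∈ B := by simpa using he
    simp [he']

end Theory

end GGreen

/-! ### From `Diagram` to `GenDiagram`; factorization of the sum over glued diagrams -/

namespace GGreen

namespace GenDiagram

variable {n M k l v m : ℕ}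

/-- A diagram labelled by `Fin v` and `Fin m` as a `Diagram`. -/
def toDiagram (x : GenDiagram n M (Fin v) (Fin m)) : Diagram n where
  V := v
  E := m
  src := x.src
  tgt := x.tgt
  leg := x.leg
  sgn := x.sgn
  ord w := x.ord w

theorem sum_singletonIf {ι P V : Type*} [Fintype ι] [DecidableEq V] (g : ι → V) (a : ι → P)
    (v : V) : ∑ i, singletonIf (g i = v) (a i) =
      (Finset.univ.filter fun i => g i = v).val.map a := by
  classical
  have h : ∀ s : Multiset ι, (s.map fun i => ({a i} : Multiset P)).sum = s.map a := fun s => by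
    rw [← Multiset.sum_map_singleton (s.map a), Multiset.map_map]
    rfl
  rw [← h]
  change _ = ∑ i ∈ Finset.univ.filter (fun i => g i = v), {a i}
  rw [Finset.sum_filter]
  refine Finset.sum_congr rfl fun i _ => ?_
  unfold singletonIf
  split_ifs <;> rfl

theorem incoming_toDiagram {P : Type*} [AddCommGroup P] (x : GenDiagram n M (Fin v) (Fin m))
    (p : Fin n → P) (q : Fin m → P) (w : Fin v) :
    x.toDiagram.incoming p q w = x.incoming p q w := by
  unfold incoming
  simp only [sum_singletonIf]
  rfl

theorem degree_toDiagram (x : GenDiagram n M (Fin v) (Fin m)) (w : Fin v) :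
    x.toDiagram.degree w = x.degree w := by
  unfold degree
  rw [← incoming_toDiagram]
  simp only [Diagram.degree, Diagram.incoming, Multiset.card_add]
  refine congrArg₂ (· + ·) (congrArg₂ (· + ·) ?_ ?_) ?_ <;> exact (Multiset.card_map _ _).symm

theorem isConnected_toDiagram (x : GenDiagram n M (Fin v) (Fin m)) :
    x.toDiagram.IsConnected ↔ x.IsConnected :=
  and_congr Fin.pos_iff_nonempty Iff.rfl

theorem separates_toDiagram {x : GenDiagram (k + l) M (Fin v) (Fin m)} (hx : x.IsConnected)
    (e : Fin m) : x.toDiagram.Separates e ↔ x.HasCut e :=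
  (hasCut_iff hx e).symm

end GenDiagram

/-- The summand ignores the Boolean variable, the orientation of the joining edge; this is where the
factor 1/2 is spent. -/
theorem mul_sum_mul_sum_eq {ι Y Z : Type*} [Fintype Y] [Fintype Z] (s : Finset ι) (c : ℂ)
    (f : ι → Y → ℂ) (g : ι → Z → ℂ) :
    c * ∑ i ∈ s, (∑ y, f i y) * ∑ z, g i z =
      2⁻¹ * ∑ w : Y × Z × Bool, c * ∑ i ∈ s, f i w.1 * g i w.2.1 := by
  have h : ∀ i, (∑ y, f i y) * ∑ z, g i z = ∑ y, ∑ z, f i y * g i z := fun i =>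
    Finset.sum_mul_sum _ _ _ _
  have h' : ∑ i ∈ s, ∑ y, ∑ z, f i y * g i z = ∑ y, ∑ z, ∑ i ∈ s, f i y * g i z := by
    rw [Finset.sum_comm]
    exact Finset.sum_congr rfl fun y _ => Finset.sum_comm
  simp only [h, h', Fintype.sum_prod_type, Finset.sum_const, Finset.card_univ, Fintype.card_bool,
    nsmul_eq_mul]
  simp only [← Finset.mul_sum]
  push_cast
  ring

namespace Theory

open GenDiagram

variable {n M k l v m : ℕ} {V E V₁ V₂ E₁ E₂ : Type}
variable {Ω K : Type*} [AddCommGroup Ω] [AddCommGroup K] [MeasureSpace Ω] [MeasureSpace K]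

theorem toDiagram_mem_diagrams (T : Theory Ω K) (x : GenDiagram n M (Fin v) (Fin m)) (N : ℕ)
    (ε : Fin n → ℤˣ) : x.toDiagram ∈ T.diagrams N ε ↔ x.IsGood T.maxDeg N ε := by
  constructor
  · rintro ⟨h1, h2, h3, h4, h5⟩
    exact ⟨x.isConnected_toDiagram.1 h1, h2, h3, h4, fun w => x.degree_toDiagram w ▸ h5 w⟩
  · rintro ⟨h1, h2, h3, h4, h5⟩
    exact ⟨x.isConnected_toDiagram.2 h1, h2, h3, h4,
      fun w => (x.degree_toDiagram w).symm ▸ h5 w⟩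

theorem integrand_toDiagram (T : Theory Ω K) (x : GenDiagram n M (Fin v) (Fin m))
    (p : Fin n → Ω × K) : T.integrand x.toDiagram p = T.genIntegrand x p := by
  funext q
  refine congrArg₂ (· * ·) rfl (Finset.prod_congr rfl fun w _ => ?_)
  change T.delta (x.toDiagram.incoming p q w).sum *
    T.vertex (x.sgn w) (x.ord w) (x.toDiagram.incoming p q w) = _
  rw [x.incoming_toDiagram p q w]

theorem contribution_toDiagram (T : Theory Ω K) (x : GenDiagram n M (Fin v) (Fin m))
    (p : Fin n → Ω × K) :
    T.contribution x.toDiagram p = labelWeight v m * T.genIntegral x p := by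
  unfold contribution
  rw [integrand_toDiagram]
  rfl

open Classical in
-- The bounds depend on `N` and not on `a`, so that both factors of every term with `a + b = N` are
-- sums over the same box.
theorem finsum_diagrams (T : Theory Ω K) {a N : ℕ} (ha : a ≤ N) (ε : Fin n → ℤˣ)
    (f : Diagram n → ℂ) :
    ∑ᶠ D ∈ T.diagrams a ε, f D = ∑ v ∈ Finset.range (N + 1),
      ∑ m ∈ Finset.range (N * ∑ j ∈ Finset.range (N + 1), T.maxDeg j + 1),
        ∑ x : GenDiagram n (N + 1) (Fin v) (Fin m),
          if x.IsGood T.maxDeg a ε then f x.toDiagram else 0 := by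
  rw [finsum_mem_eq_finite_toFinset_sum _ (T.diagrams_finite a ε)]
  simp_rw [Finset.sum_sigma']
  rw [← Finset.sum_filter]
  symm
  refine Finset.sum_nbij (fun t => t.2.2.toDiagram) ?_ ?_ ?_ fun _ _ => rfl
  · rintro ⟨v, m, x⟩ h
    rw [Set.Finite.mem_toFinset, toDiagram_mem_diagrams]
    exact (Finset.mem_filter.1 h).2
  · rintro ⟨v, m, x⟩ - ⟨v', m', x'⟩ - h
    simp only [toDiagram, Diagram.mk.injEq] at h
    obtain ⟨rfl, rfl, h1, h2, h3, h4, h5⟩ := h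
    have : x = x' := by
      refine GenDiagram.ext (eq_of_heq h1) (eq_of_heq h2) (eq_of_heq h3) (eq_of_heq h4) ?_
      funext w
      exact Fin.ext (congrFun (eq_of_heq h5) w)
    rw [this]
  · intro D hD
    have hD' : D ∈ T.diagrams a ε := by simpa using hD
    have hord : ∀ w, D.ord w < N + 1 := fun w => by
      have h : D.ord w ≤ ∑ v, D.ord v :=
        Finset.single_le_sum (fun i _ => Nat.zero_le (D.ord i)) (Finset.mem_univ w)
      rw [hD'.2.2.2.1] at h
      omega
    let x : GenDiagram n (N + 1) (Fin D.V) (Fin D.E) :=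
      ⟨D.src, D.tgt, D.leg, D.sgn, fun w => ⟨D.ord w, hord w⟩⟩
    have hx : x.IsGood T.maxDeg a ε := (T.toDiagram_mem_diagrams x a ε).1 hD'
    have h1 := hx.card_le
    have h2 := hx.card_edges_le ha
    rw [Fintype.card_fin] at h1 h2
    refine ⟨⟨D.V, D.E, x⟩, ?_, rfl⟩
    simp only [Finset.coe_filter, Finset.mem_sigma, Finset.mem_range, Finset.mem_univ, and_true]
    exact ⟨⟨Nat.lt_succ_of_le (h1.trans ha), Nat.lt_succ_of_le h2⟩, hx⟩

open Classical in
/-- The integral of a diagram if it has order `a` and external signs `ε` and satisfies `c`,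
otherwise `0`. -/
noncomputable def genTerm [Fintype V] [Fintype E] (T : Theory Ω K) (x : GenDiagram n M V E)
    (c : Prop) (a : ℕ) (p : Fin n → Ω × K) (ε : Fin n → ℤˣ) : ℂ :=
  if x.IsGood T.maxDeg a ε ∧ c then T.genIntegral x p else 0

/-- The sum of the integrals of all diagrams with `v` vertices and `m` edges that satisfy `Q`. -/
noncomputable def genSum (T : Theory Ω K) (Q : GenDiagram n M (Fin v) (Fin m) → Prop) (a : ℕ)
    (p : Fin n → Ω × K) (ε : Fin n → ℤˣ) : ℂ :=
  ∑ x : GenDiagram n M (Fin v) (Fin m), T.genTerm x (Q x) a p ε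

variable [MeasurableNeg Ω] [MeasurableNeg K]
  [SigmaFinite (volume : Measure Ω)] [SigmaFinite (volume : Measure K)]

theorem Convergent.integrable_of_isGood [Fintype V] [Fintype E] {T : Theory Ω K}
    (hT : T.Convergent) {x : GenDiagram n M V E} {N : ℕ} {ε : Fin n → ℤˣ}
    (hx : x.IsGood T.maxDeg N ε) {p : Fin n → Ω × K} (hp : ∀ i, p i ∈ T.shell) :
    Integrable (T.genIntegrand x p) (T.genMeasure x) := by
  refine T.integrable_relabel (Fintype.equivFin V) (Fintype.equivFin E) x p ?_
  rw [← integrand_toDiagram]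
  exact hT n N ε p hp _ ((T.toDiagram_mem_diagrams _ N ε).2 (hx.relabel _ _))

open Classical in
-- The diagrams `y` and `z` determine their orders, so at most one term of the antidiagonal sum is
-- non-zero; if the glued diagram is not marked, all terms vanish.
theorem Convergent.integral_marked_glue [Fintype V₁] [Fintype E₁] [Fintype V₂] [Fintype E₂]
    {T : Theory Ω K} (hT : T.Convergent) (N : ℕ) (hl : 1 ≤ l) (r : Prop) (p : Fin k → Ω × K)
    (ε : Fin k → ℤˣ) (p' : Fin l → Ω × K) (ε' : Fin l → ℤˣ) (hp : ∀ i, p i ∈ T.shell)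
    (hp' : ∀ j, p' j ∈ T.shell) (y : GenDiagram (k + 1) M V₁ E₁)
    (z : GenDiagram (l + 1) M V₂ E₂) (o : Bool) :
    let F : Ω × K → ℂ := fun q => T.prop 1 (-1) q *
      ∑ ab ∈ Finset.HasAntidiagonal.antidiagonal N,
        T.genTerm y (r → ∀ f, ¬ y.HasCut f) ab.1 (Fin.snoc p q) (Fin.snoc ε 1) *
          T.genTerm z True ab.2 (Fin.snoc p' (-q)) (Fin.snoc ε' (-1))
    Integrable F (T.propMeasure 1 (-1)) ∧
      (if (glue y z o).IsMarked T.maxDeg N (Fin.append ε ε') r (Sum.inr ()) (Set.range Sum.inl)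
        then T.genIntegral (glue y z o) (Fin.append p p') else 0) =
        ∫ q, F q ∂(T.propMeasure 1 (-1)) := by
  intro F
  by_cases hm : (glue y z o).IsMarked T.maxDeg N (Fin.append ε ε') r (Sum.inr ())
      (Set.range Sum.inl)
  · obtain ⟨ab, hab, hy, hz⟩ := (isGood_glue y z o T.maxDeg N ε ε').1 ⟨hm.1, hm.2.1⟩
    have hirr := (isFirst_glue r y z o hl hz.conn).1 hm.2.2
    have hF : F = fun q => T.prop 1 (-1) q *
        (T.genIntegral y (Fin.snoc p q : Fin (k + 1) → Ω × K) *
          T.genIntegral z (Fin.snoc p' (-q) : Fin (l + 1) → Ω × K)) := by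
      funext q
      simp only [F, genTerm]
      rw [Finset.sum_eq_single ab]
      · rw [if_pos ⟨hy, hirr⟩, if_pos ⟨hz, trivial⟩]
      · intro ab' _ hne
        by_cases h1 : y.IsGood T.maxDeg ab'.1 (Fin.snoc ε 1 : Fin (k + 1) → ℤˣ) ∧
            (r → ∀ f, ¬ y.HasCut f)
        · by_cases h2 : z.IsGood T.maxDeg ab'.2 (Fin.snoc ε' (-1) : Fin (l + 1) → ℤˣ) ∧ True
          · exact absurd (Prod.ext (h1.1.sum_ord.symm.trans hy.sum_ord)
              (h2.1.sum_ord.symm.trans hz.sum_ord)) hne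
          · rw [if_neg h2, mul_zero]
        · rw [if_neg h1, zero_mul]
      · exact fun h => absurd hab h
    rw [if_pos hm, hF]
    refine T.integral_glue y z o (by simpa using hy.sgn_leg (Fin.last k))
      (by simpa using hz.sgn_leg (Fin.last l)) p p' (hT.integrable_of_isGood hm.1 ?_)
    refine Fin.addCases (fun i => ?_) fun j => ?_
    · simpa using hp i
    · simpa using hp' j
  · have hF : F = fun _ => 0 := by
      funext q
      simp only [F, genTerm]
      rw [Finset.sum_eq_zero, mul_zero]
      intro ab hab
      by_cases h1 : y.IsGood T.maxDeg ab.1 (Fin.snoc ε 1 : Fin (k + 1) → ℤˣ) ∧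
          (r → ∀ f, ¬ y.HasCut f)
      · by_cases h2 : z.IsGood T.maxDeg ab.2 (Fin.snoc ε' (-1) : Fin (l + 1) → ℤˣ) ∧ True
        · have := (isGood_glue y z o T.maxDeg N ε ε').2 ⟨ab, hab, h1.1, h2.1⟩
          exact absurd ⟨this.1, this.2, (isFirst_glue r y z o hl h2.1.conn).2 h1.2⟩ hm
        · rw [if_neg h2, mul_zero]
      · rw [if_neg h1, zero_mul]
    rw [if_neg hm, hF]
    simp

theorem Convergent.glueSum_eq {T : Theory Ω K} (hT : T.Convergent) (N : ℕ) (hl : 1 ≤ l)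
    (r : Prop) (p : Fin k → Ω × K) (ε : Fin k → ℤˣ) (p' : Fin l → Ω × K) (ε' : Fin l → ℤˣ)
    (hp : ∀ i, p i ∈ T.shell) (hp' : ∀ j, p' j ∈ T.shell) (v₁ v₂ m₁ m₂ : ℕ) :
    let F : Ω × K → ℂ := fun q => T.prop 1 (-1) q *
      ∑ ab ∈ Finset.HasAntidiagonal.antidiagonal N,
        T.genSum (fun y : GenDiagram (k + 1) M (Fin v₁) (Fin m₁) => r → ∀ f, ¬ y.HasCut f) ab.1
          (Fin.snoc p q) (Fin.snoc ε 1) *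
        T.genSum (fun _ : GenDiagram (l + 1) M (Fin v₂) (Fin m₂) => True) ab.2
          (Fin.snoc p' (-q)) (Fin.snoc ε' (-1))
    Integrable F (T.propMeasure 1 (-1)) ∧
      2⁻¹ * T.glueSum M N r p ε p' ε' v₁ v₂ m₁ m₂ = ∫ q, F q ∂(T.propMeasure 1 (-1)) := by
  classical
  intro F
  let H : GenDiagram (k + 1) M (Fin v₁) (Fin m₁) × GenDiagram (l + 1) M (Fin v₂) (Fin m₂) × Bool →
      Ω × K → ℂ := fun w q => T.prop 1 (-1) q *
        ∑ ab ∈ Finset.HasAntidiagonal.antidiagonal N,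
          T.genTerm w.1 (r → ∀ f, ¬ w.1.HasCut f) ab.1 (Fin.snoc p q) (Fin.snoc ε 1) *
            T.genTerm w.2.1 True ab.2 (Fin.snoc p' (-q)) (Fin.snoc ε' (-1))
  have hint : ∀ w, Integrable (H w) (T.propMeasure 1 (-1)) := fun w =>
    (hT.integral_marked_glue N hl r p ε p' ε' hp hp' w.1 w.2.1 w.2.2).1
  have hF : F = fun q => 2⁻¹ * ∑ w, H w q := by
    funext q
    simp only [F, H, genSum]
    rw [mul_sum_mul_sum_eq _ (T.prop 1 (-1) q)
      (fun (ab : ℕ × ℕ) (y : GenDiagram (k + 1) M (Fin v₁) (Fin m₁)) =>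
        T.genTerm y (r → ∀ f, ¬ y.HasCut f) ab.1 (Fin.snoc p q) (Fin.snoc ε 1))
      (fun (ab : ℕ × ℕ) (z : GenDiagram (l + 1) M (Fin v₂) (Fin m₂)) =>
        T.genTerm z True ab.2 (Fin.snoc p' (-q)) (Fin.snoc ε' (-1)))]
  rw [hF]
  refine ⟨(integrable_finsetSum _ fun w _ => hint w).const_mul _, ?_⟩
  rw [integral_const_mul, integral_finsetSum _ fun w _ => hint w]
  unfold glueSum
  congr 1
  exact Finset.sum_congr rfl fun w _ =>
    (hT.integral_marked_glue N hl r p ε p' ε' hp hp' w.1 w.2.1 w.2.2).2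

end Theory

end GGreen

/-! ### Summation over all diagrams, first separating edges and renormalization -/

namespace GGreen

theorem mul_sum_weighted_mul_sum_weighted {ι : Type*} (s : Finset ι) (R Q : Finset ℕ) (c : ℂ)
    (w : ℕ → ℕ → ℂ) (f g : ι → ℕ → ℕ → ℂ) :
    c * ∑ i ∈ s, (∑ v ∈ R, ∑ m ∈ Q, w v m * f i v m) * (∑ v ∈ R, ∑ m ∈ Q, w v m * g i v m) =
      ∑ v₁ ∈ R, ∑ v₂ ∈ R, ∑ m₁ ∈ Q, ∑ m₂ ∈ Q,
        w v₁ m₁ * w v₂ m₂ * (c * ∑ i ∈ s, f i v₁ m₁ * g i v₂ m₂) := by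
  have h : ∀ i, (∑ v ∈ R, ∑ m ∈ Q, w v m * f i v m) * (∑ v ∈ R, ∑ m ∈ Q, w v m * g i v m) =
      ∑ v₁ ∈ R, ∑ v₂ ∈ R, ∑ m₁ ∈ Q, ∑ m₂ ∈ Q, w v₁ m₁ * f i v₁ m₁ * (w v₂ m₂ * g i v₂ m₂) :=
    fun i => by
      rw [Finset.sum_mul_sum]
      exact Finset.sum_congr rfl fun v₁ _ => Finset.sum_congr rfl fun v₂ _ =>
        Finset.sum_mul_sum _ _ _ _
  simp only [h, Finset.mul_sum]
  rw [Finset.sum_comm]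
  refine Finset.sum_congr rfl fun v₁ _ => ?_
  rw [Finset.sum_comm]
  refine Finset.sum_congr rfl fun v₂ _ => ?_
  rw [Finset.sum_comm]
  refine Finset.sum_congr rfl fun m₁ _ => ?_
  rw [Finset.sum_comm]
  exact Finset.sum_congr rfl fun m₂ _ => Finset.sum_congr rfl fun i _ => by ring

namespace Theory

open GenDiagram

variable {n M k l v m : ℕ}
variable {Ω K : Type*} [AddCommGroup Ω] [AddCommGroup K] [MeasureSpace Ω] [MeasureSpace K]

open Classical in
/-- The term of order `a` of the connected amputated GGreen function, without the diagrams with an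
edge separating the last leg from the others in case that `r` holds. -/
noncomputable def restrictedGhat (T : Theory Ω K) (r : Prop) (a : ℕ) (p : Fin (k + 1) → Ω × K)
    (ε : Fin (k + 1) → ℤˣ) : ℂ :=
  ∑ᶠ D ∈ T.diagrams a ε, if r → ∀ e, ¬ Diagram.Separates (k := k) (l := 1) D e
    then T.contribution D p else 0

theorem restrictedGhat_eq_sum (T : Theory Ω K) (r : Prop) {a N : ℕ} (ha : a ≤ N)
    (p : Fin (k + 1) → Ω × K) (ε : Fin (k + 1) → ℤˣ) :
    T.restrictedGhat r a p ε = ∑ v ∈ Finset.range (N + 1),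
      ∑ m ∈ Finset.range (N * ∑ j ∈ Finset.range (N + 1), T.maxDeg j + 1), labelWeight v m *
        T.genSum (fun y : GenDiagram (k + 1) (N + 1) (Fin v) (Fin m) => r → ∀ f, ¬ y.HasCut f)
          a p ε := by
  classical
  unfold restrictedGhat
  rw [T.finsum_diagrams ha]
  refine Finset.sum_congr rfl fun v _ => Finset.sum_congr rfl fun m _ => ?_
  unfold genSum
  rw [Finset.mul_sum]
  refine Finset.sum_congr rfl fun x _ => ?_
  unfold genTerm
  by_cases hx : x.IsGood T.maxDeg a ε
  · have h : (r → ∀ e, ¬ Diagram.Separates (k := k) (l := 1) x.toDiagram e) ↔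
        (r → ∀ f, ¬ x.HasCut f) :=
      imp_congr_right fun _ => forall_congr' fun e => not_congr (separates_toDiagram hx.conn e)
    by_cases hc : r → ∀ f, ¬ x.HasCut f
    · rw [if_pos hx, if_pos (h.2 hc), if_pos ⟨hx, hc⟩, contribution_toDiagram]
    · rw [if_pos hx, if_neg fun h' => hc (h.1 h'), if_neg fun h' => hc h'.2, mul_zero]
  · rw [if_neg hx, if_neg fun h => hx h.1, mul_zero]

theorem Ghat_eq_sum (T : Theory Ω K) {a N : ℕ} (ha : a ≤ N) (p : Fin n → Ω × K)
    (ε : Fin n → ℤˣ) :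
    T.Ghat a p ε = ∑ v ∈ Finset.range (N + 1),
      ∑ m ∈ Finset.range (N * ∑ j ∈ Finset.range (N + 1), T.maxDeg j + 1), labelWeight v m *
        T.genSum (fun _ : GenDiagram n (N + 1) (Fin v) (Fin m) => True) a p ε := by
  classical
  unfold Ghat
  rw [T.finsum_diagrams ha]
  refine Finset.sum_congr rfl fun v _ => Finset.sum_congr rfl fun m _ => ?_
  unfold genSum
  rw [Finset.mul_sum]
  refine Finset.sum_congr rfl fun x _ => ?_
  unfold genTerm
  by_cases hx : x.IsGood T.maxDeg a ε
  · rw [if_pos hx, if_pos ⟨hx, trivial⟩, contribution_toDiagram]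
  · rw [if_neg hx, if_neg fun h => hx h.1, mul_zero]

theorem restrictedGhat_false (T : Theory Ω K) (a : ℕ) (p : Fin (k + 1) → Ω × K)
    (ε : Fin (k + 1) → ℤˣ) : T.restrictedGhat False a p ε = T.Ghat a p ε := by
  unfold restrictedGhat Ghat
  exact finsum_mem_congr rfl fun D _ => if_pos fun h => h.elim

open Classical in
theorem sepSum_eq_finsum_ite (T : Theory Ω K) (a : ℕ) (p : Fin (k + l) → Ω × K)
    (ε : Fin (k + l) → ℤˣ) : T.sepSum a k l p ε =
      ∑ᶠ D ∈ T.diagrams a ε, (if ∃ e, D.Separates e then (1 : ℂ) else 0) *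
        T.contribution D p := by
  unfold sepSum
  have hfin := T.diagrams_finite a ε
  rw [finsum_mem_eq_finite_toFinset_sum _ hfin,
    finsum_mem_eq_finite_toFinset_sum _ (hfin.subset (Set.sep_subset _ _))]
  simp only [ite_mul, one_mul, zero_mul]
  rw [← Finset.sum_filter]
  refine Finset.sum_congr ?_ fun _ _ => rfl
  ext D
  simp

theorem Ghat_eq_restrictedGhat_add_sepSum (T : Theory Ω K) (a : ℕ) (p : Fin (k + 1) → Ω × K)
    (ε : Fin (k + 1) → ℤˣ) :
    T.Ghat a p ε = T.restrictedGhat True a p ε + T.sepSum a k 1 p ε := by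
  classical
  rw [sepSum_eq_finsum_ite]
  unfold Ghat restrictedGhat
  rw [← finsum_mem_add_distrib (T.diagrams_finite a ε)]
  refine finsum_mem_congr rfl fun D _ => ?_
  by_cases h : ∃ e, Diagram.Separates (k := k) (l := 1) D e
  · rw [if_neg (by simpa using h), if_pos h]; simp
  · rw [if_pos (by simpa using h), if_neg h]; simp

variable [MeasurableNeg Ω] [MeasurableNeg K]
  [SigmaFinite (volume : Measure Ω)] [SigmaFinite (volume : Measure K)]

open Classical in
-- The common source of both counts: the multiplicity `c D` is the number of separating edges for `r
-- = False`, and it counts only first ones for `r = True`.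
theorem Convergent.finsum_marked {T : Theory Ω K} (hT : T.Convergent) (N : ℕ) (hl : 1 ≤ l)
    (r : Prop) (p : Fin k → Ω × K) (ε : Fin k → ℤˣ) (p' : Fin l → Ω × K) (ε' : Fin l → ℤˣ)
    (hp : ∀ i, p i ∈ T.shell) (hp' : ∀ j, p' j ∈ T.shell) (c : Diagram (k + l) → ℂ)
    (hc : ∀ (v m : ℕ) (x : GenDiagram (k + l) (N + 1) (Fin v) (Fin m)), x.IsConnected →
      c x.toDiagram = ∑ e : Fin m, ∑ A : Finset (Fin v),
        if x.IsCut e A ∧ x.IsFirst r A then 1 else 0) :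
    let F : Ω × K → ℂ := fun q => T.prop 1 (-1) q *
      ∑ ab ∈ Finset.HasAntidiagonal.antidiagonal N,
        T.restrictedGhat r ab.1 (Fin.snoc p q : Fin (k + 1) → Ω × K)
          (Fin.snoc ε 1 : Fin (k + 1) → ℤˣ) *
        T.Ghat ab.2 (Fin.snoc p' (-q) : Fin (l + 1) → Ω × K)
          (Fin.snoc ε' (-1) : Fin (l + 1) → ℤˣ)
    Integrable F (T.propMeasure 1 (-1)) ∧
      ∑ᶠ D ∈ T.diagrams N (Fin.append ε ε'), c D * T.contribution D (Fin.append p p') =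
        ∫ q, F q ∂(T.propMeasure 1 (-1)) := by
  intro F
  set B := N * ∑ j ∈ Finset.range (N + 1), T.maxDeg j with hB
  let H : ℕ → ℕ → ℕ → ℕ → Ω × K → ℂ := fun v₁ v₂ m₁ m₂ q => T.prop 1 (-1) q *
      ∑ ab ∈ Finset.HasAntidiagonal.antidiagonal N,
        T.genSum (fun y : GenDiagram (k + 1) (N + 1) (Fin v₁) (Fin m₁) => r → ∀ f, ¬ y.HasCut f)
          ab.1 (Fin.snoc p q) (Fin.snoc ε 1) *
        T.genSum (fun _ : GenDiagram (l + 1) (N + 1) (Fin v₂) (Fin m₂) => True) ab.2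
          (Fin.snoc p' (-q)) (Fin.snoc ε' (-1))
  have hH : ∀ v₁ v₂ m₁ m₂, Integrable (H v₁ v₂ m₁ m₂) (T.propMeasure 1 (-1)) ∧
      2⁻¹ * T.glueSum (N + 1) N r p ε p' ε' v₁ v₂ m₁ m₂ =
        ∫ q, H v₁ v₂ m₁ m₂ q ∂(T.propMeasure 1 (-1)) :=
    fun v₁ v₂ m₁ m₂ => hT.glueSum_eq N hl r p ε p' ε' hp hp' v₁ v₂ m₁ m₂
  have hF : F = fun q => ∑ v₁ ∈ Finset.range (N + 1), ∑ v₂ ∈ Finset.range (N + 1),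
      ∑ m₁ ∈ Finset.range (B + 1), ∑ m₂ ∈ Finset.range (B + 1),
        labelWeight v₁ m₁ * labelWeight v₂ m₂ * H v₁ v₂ m₁ m₂ q := by
    funext q
    refine Eq.trans ?_ (mul_sum_weighted_mul_sum_weighted
      (Finset.HasAntidiagonal.antidiagonal N) (Finset.range (N + 1)) (Finset.range (B + 1))
      (T.prop 1 (-1) q) labelWeight
      (fun (ab : ℕ × ℕ) v m => T.genSum
        (fun y : GenDiagram (k + 1) (N + 1) (Fin v) (Fin m) => r → ∀ f, ¬ y.HasCut f)
          ab.1 (Fin.snoc p q) (Fin.snoc ε 1))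
      (fun (ab : ℕ × ℕ) v m => T.genSum
        (fun _ : GenDiagram (l + 1) (N + 1) (Fin v) (Fin m) => True) ab.2
          (Fin.snoc p' (-q)) (Fin.snoc ε' (-1))))
    simp only [F]
    congr 1
    refine Finset.sum_congr rfl fun ab hab => ?_
    have h := Finset.HasAntidiagonal.mem_antidiagonal.1 hab
    rw [T.restrictedGhat_eq_sum r (show ab.1 ≤ N by omega),
      T.Ghat_eq_sum (show ab.2 ≤ N by omega)]
  have hint : ∀ v₁ v₂ m₁ m₂, Integrable
      (fun q => labelWeight v₁ m₁ * labelWeight v₂ m₂ * H v₁ v₂ m₁ m₂ q)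
      (T.propMeasure 1 (-1)) := fun v₁ v₂ m₁ m₂ => (hH v₁ v₂ m₁ m₂).1.const_mul _
  have hint₁ := fun v₁ v₂ m₁ =>
    integrable_finsetSum (Finset.range (B + 1)) fun m₂ _ => hint v₁ v₂ m₁ m₂
  have hint₂ := fun v₁ v₂ =>
    integrable_finsetSum (Finset.range (B + 1)) fun m₁ _ => hint₁ v₁ v₂ m₁
  have hint₃ := fun v₁ =>
    integrable_finsetSum (Finset.range (N + 1)) fun v₂ _ => hint₂ v₁ v₂
  rw [hF]
  refine ⟨integrable_finsetSum _ fun v₁ _ => hint₃ v₁, ?_⟩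
  rw [T.finsum_diagrams le_rfl]
  have hL : ∀ v ∈ Finset.range (N + 1), ∀ m ∈ Finset.range (B + 1),
      (∑ x : GenDiagram (k + l) (N + 1) (Fin v) (Fin m),
        if x.IsGood T.maxDeg N (Fin.append ε ε') then
          c x.toDiagram * T.contribution x.toDiagram (Fin.append p p') else 0) =
      labelWeight v m * ∑ v₁ ∈ Finset.range (v + 1), v.choose v₁ •
        ∑ m₁ ∈ Finset.range (m + 1), m.choose m₁ • (m - m₁) •
          T.glueSum (N + 1) N r p ε p' ε' v₁ (v - v₁) m₁ (m - m₁ - 1) := by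
    intro v _ m _
    have := T.sum_isMarked (M := N + 1) (V := Fin v) (E := Fin m) N r p ε p' ε'
    simp only [Fintype.card_fin] at this
    rw [← this, Finset.mul_sum]
    refine Finset.sum_congr rfl fun x _ => ?_
    by_cases hx : x.IsGood T.maxDeg N (Fin.append ε ε')
    · rw [if_pos hx, hc v m x hx.conn, contribution_toDiagram]
      simp only [IsMarked, hx, true_and, Finset.sum_mul, Finset.mul_sum]
      refine Finset.sum_congr rfl fun e _ => Finset.sum_congr rfl fun A _ => ?_
      split_ifs <;> ring
    · simp [IsMarked, hx]
  -- Sums over the size of the whole and its splittings become independent sums over the sizes of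
  -- the parts, since `glueSum` vanishes when the whole is too large.
  rw [Finset.sum_congr rfl fun v hv => Finset.sum_congr rfl fun m hm => hL v hv m hm,
    sum_labelWeight_split N B _ (T.glueSum_eq_zero_of_lt_vertices N r p ε p' ε')
      (T.glueSum_eq_zero_of_lt_edges N r p ε p' ε'),
    integral_finsetSum _ fun v₁ _ => hint₃ v₁]
  refine Finset.sum_congr rfl fun v₁ _ => ?_
  rw [integral_finsetSum _ fun v₂ _ => hint₂ v₁ v₂]
  refine Finset.sum_congr rfl fun v₂ _ => ?_
  rw [integral_finsetSum _ fun m₁ _ => hint₁ v₁ v₂ m₁]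
  refine Finset.sum_congr rfl fun m₁ _ => ?_
  rw [integral_finsetSum _ fun m₂ _ => hint v₁ v₂ m₁ m₂]
  refine Finset.sum_congr rfl fun m₂ _ => ?_
  rw [integral_const_mul, ← (hH v₁ v₂ m₁ m₂).2, mul_assoc]

open Classical in
-- The side is determined by the edge (`IsCut.unique`), so each edge counts once.
theorem sum_isCut_eq {r : Prop} {x : GenDiagram (k + l) M (Fin v) (Fin m)} (hx : x.IsConnected) :
    (∑ e : Fin m, ∑ A : Finset (Fin v), if x.IsCut e A ∧ x.IsFirst r A then (1 : ℂ) else 0) =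
      (Set.ncard {e | ∃ A, x.IsCut e A ∧ x.IsFirst r A} : ℂ) := by
  rw [Set.ncard_eq_toFinset_card', Finset.card_eq_sum_ones, Nat.cast_sum, Set.toFinset_ofPred,
    Finset.sum_filter]
  refine Finset.sum_congr rfl fun e _ => ?_
  by_cases h : ∃ A, x.IsCut e A ∧ x.IsFirst r A
  · rw [if_pos h]
    obtain ⟨A, hA, hA'⟩ := h
    rw [Finset.sum_eq_single A.toFinset]
    · simp [hA, hA']
    · intro A' _ hne
      refine if_neg fun h => hne ?_
      rw [← Finset.coe_inj, h.1.unique hx hA]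
      simp
    · simp
  · rw [if_neg h]
    exact Finset.sum_eq_zero fun A _ => if_neg fun h' => h ⟨A, h'⟩

theorem Convergent.sepSumMarked_eq {T : Theory Ω K} (hT : T.Convergent) (N : ℕ) (hl : 1 ≤ l)
    (p : Fin k → Ω × K) (ε : Fin k → ℤˣ) (p' : Fin l → Ω × K) (ε' : Fin l → ℤˣ)
    (hp : ∀ i, p i ∈ T.shell) (hp' : ∀ j, p' j ∈ T.shell) :
    let F : Ω × K → ℂ := fun q => T.prop 1 (-1) q *
      ∑ ab ∈ Finset.HasAntidiagonal.antidiagonal N,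
        T.Ghat ab.1 (Fin.snoc p q : Fin (k + 1) → Ω × K) (Fin.snoc ε 1 : Fin (k + 1) → ℤˣ) *
        T.Ghat ab.2 (Fin.snoc p' (-q) : Fin (l + 1) → Ω × K)
          (Fin.snoc ε' (-1) : Fin (l + 1) → ℤˣ)
    Integrable F (T.propMeasure 1 (-1)) ∧
      T.sepSumMarked N k l (Fin.append p p') (Fin.append ε ε') =
        ∫ q, F q ∂(T.propMeasure 1 (-1)) := by
  have := hT.finsum_marked N hl False p ε p' ε' hp hp'
    (fun D => (Set.ncard {e | D.Separates e} : ℂ)) fun v m x hx => by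
      rw [sum_isCut_eq hx]
      have h : {e | x.toDiagram.Separates e} = {e | ∃ A, x.IsCut e A ∧ x.IsFirst False A} := by
        ext e
        refine (separates_toDiagram hx e).trans (exists_congr fun A => ?_)
        exact (and_iff_left fun h => h.elim).symm
      exact congrArg (fun s : Set (Fin m) => (s.ncard : ℂ)) h
  simpa only [restrictedGhat_false, sepSumMarked] using this

theorem Convergent.sepSum_eq {T : Theory Ω K} (hT : T.Convergent) (N : ℕ) (hk : 1 ≤ k)
    (hl : 1 ≤ l) (p : Fin k → Ω × K) (ε : Fin k → ℤˣ) (p' : Fin l → Ω × K) (ε' : Fin l → ℤˣ)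
    (hp : ∀ i, p i ∈ T.shell) (hp' : ∀ j, p' j ∈ T.shell) :
    T.sepSum N k l (Fin.append p p') (Fin.append ε ε') =
      ∫ q, T.prop 1 (-1) q * ∑ ab ∈ Finset.HasAntidiagonal.antidiagonal N,
        T.restrictedGhat True ab.1 (Fin.snoc p q : Fin (k + 1) → Ω × K)
          (Fin.snoc ε 1 : Fin (k + 1) → ℤˣ) *
        T.Ghat ab.2 (Fin.snoc p' (-q) : Fin (l + 1) → Ω × K)
          (Fin.snoc ε' (-1) : Fin (l + 1) → ℤˣ) ∂(T.propMeasure 1 (-1)) := by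
  classical
  rw [sepSum_eq_finsum_ite]
  refine (hT.finsum_marked N hl True p ε p' ε' hp hp'
    (fun D => if ∃ e, D.Separates e then (1 : ℂ) else 0) fun v m x hx => ?_).2
  have hsep : (∃ e, x.toDiagram.Separates e) ↔ ∃ e, x.HasCut e :=
    exists_congr fun e => separates_toDiagram hx e
  rw [sum_isCut_eq hx]
  by_cases h : ∃ e, x.HasCut e
  · rw [if_pos (hsep.2 h)]
    obtain ⟨e, he, huniq⟩ := existsUnique_first hx hk hl h
    have : {e | ∃ A, x.IsCut e A ∧ x.IsFirst True A} = {e} :=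
      Set.eq_singleton_iff_unique_mem.2 ⟨he, fun f hf => huniq f hf⟩
    rw [this, Set.ncard_singleton, Nat.cast_one]
  · rw [if_neg fun h' => h (hsep.1 h')]
    have : {e | ∃ A, x.IsCut e A ∧ x.IsFirst True A} = ∅ :=
      Set.eq_empty_iff_forall_notMem.2 fun e ⟨A, hA, _⟩ => h ⟨e, A, hA⟩
    rw [this, Set.ncard_empty, Nat.cast_zero]

/-- The two sides differ by the diagrams with an edge separating the last leg from the others. By
`sepSum_eq` with `l = 1` these sum to an integral over `q'` containing the two-point function with
legs `q` (sign `+`) and `-q'` (sign `-`), which vanishes since `q'` is almost everywhere on shell.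
-/
theorem Convergent.restrictedGhat_eq_Ghat [MeasurableEq Ω] {T : Theory Ω K} (hT : T.Convergent)
    (hR : T.Renormalized) (a : ℕ) (hk : 1 ≤ k) (p : Fin k → Ω × K) (ε : Fin k → ℤˣ)
    (hp : ∀ i, p i ∈ T.shell) {q : Ω × K} (hq : q ∈ T.shell) :
    T.restrictedGhat True a (Fin.snoc p q : Fin (k + 1) → Ω × K)
        (Fin.snoc ε 1 : Fin (k + 1) → ℤˣ) =
      T.Ghat a (Fin.snoc p q : Fin (k + 1) → Ω × K) (Fin.snoc ε 1 : Fin (k + 1) → ℤˣ) := by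
  have h := hT.sepSum_eq a hk le_rfl p ε ![q] ![1] hp (by simpa using hq)
  have h0 : T.sepSum a k 1 (Fin.append p ![q]) (Fin.append ε ![1]) = 0 := by
    rw [h]
    refine integral_eq_zero_of_ae ?_
    filter_upwards [T.ae_mem_shell] with q' hq'
    have e1 : (Fin.snoc ![q] (-q') : Fin (1 + 1) → Ω × K) = ![q, -q'] := by
      funext i; fin_cases i <;> rfl
    have e2 : (Fin.snoc ![1] (-1) : Fin (1 + 1) → ℤˣ) = ![1, -1] := by
      funext i; fin_cases i <;> rfl
    simp only [e1, e2, hR _ q hq (-q') (T.neg_mem_shell hq'), mul_zero, Finset.sum_const_zero,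
      Pi.zero_apply]
  have e3 : (Fin.append p ![q] : Fin (k + 1) → Ω × K) = Fin.snoc p q := by
    rw [Fin.append_right_eq_snoc]; rfl
  have e4 : (Fin.append ε ![1] : Fin (k + 1) → ℤˣ) = Fin.snoc ε 1 := by
    rw [Fin.append_right_eq_snoc]; rfl
  rw [T.Ghat_eq_restrictedGhat_add_sepSum, ← e3, ← e4, h0, add_zero]

end Theory

end GGreen

theorem lemma3 {Ω K : Type*} [AddCommGroup Ω] [AddCommGroup K] [MeasureSpace Ω] [MeasureSpace K]
    [MeasurableNeg Ω] [MeasurableNeg K] [MeasurableEq Ω]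
    [SigmaFinite (volume : Measure Ω)] [SigmaFinite (volume : Measure K)]
    [(volume : Measure Ω).IsNegInvariant] [(volume : Measure K).IsNegInvariant]
    (T : GGreen.Theory Ω K) (hT : T.Convergent)
    (N k l : ℕ) (hk : 1 ≤ k) (hl : 1 ≤ l)
    (p : Fin k → Ω × K) (ε : Fin k → ℤˣ) (p' : Fin l → Ω × K) (ε' : Fin l → ℤˣ)
    (hp : ∀ i, p i ∈ T.shell) (hp' : ∀ j, p' j ∈ T.shell) :
    let rhs : Ω × K → ℂ := fun q =>
      T.prop 1 (-1) q * ∑ ab ∈ Finset.HasAntidiagonal.antidiagonal N,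
        T.Ghat ab.1 (Fin.snoc p q : Fin (k + 1) → Ω × K) (Fin.snoc ε 1 : Fin (k + 1) → ℤˣ) *
        T.Ghat ab.2 (Fin.snoc p' (-q) : Fin (l + 1) → Ω × K)
          (Fin.snoc ε' (-1) : Fin (l + 1) → ℤˣ)
    Integrable rhs (T.propMeasure 1 (-1)) ∧
      T.sepSumMarked N k l (Fin.append p p') (Fin.append ε ε') =
        ∫ q, rhs q ∂(T.propMeasure 1 (-1)) ∧
      (T.Renormalized →
        T.sepSum N k l (Fin.append p p') (Fin.append ε ε') =
          ∫ q, rhs q ∂(T.propMeasure 1 (-1))) := by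

  intro rhs
  obtain ⟨hint, hmarked⟩ := hT.sepSumMarked_eq N hl p ε p' ε' hp hp'
  refine ⟨hint, hmarked, fun hR => ?_⟩
  rw [hT.sepSum_eq N hk hl p ε p' ε' hp hp']
  -- The restricted and the full first factor are known to agree on shell, which is almost
  -- everywhere for `propMeasure 1 (-1)`.
  refine integral_congr_ae ?_
  filter_upwards [T.ae_mem_shell] with q hq
  simp only [rhs, hT.restrictedGhat_eq_Ghat hR _ hk p ε hp hq]
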